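/- There exist real numbers $\lambda_1,\lambda_2$ and a complete, properly embedded harmonic torus with exactly one end, of type $(2,2,3)$, built on the elliptic curve $w^2=z(z-1)(z+1)$ from the forms $\frac{z+\lambda_1}{w}\,dz$, $i\frac{z+\lambda_2}{w}\,dz$, $dz$. In detail: there are a compact Riemann surface $X$ homeomorphic to the torus $S^1\times S^1$, a point $p\in X$, and holomorphic functions $z,w$ on $X'=X\setminus\{p\}$ such that $(z,w)$ maps $X'$ bijectively onto the affine curve $\{(z,w)\in\mathbb C^2 : w^2=z(z-1)(z+1)\}$, and there are $\lambda_1,\lambda_2\in\mathbb R$, such that the following holds. 1. The forms $$\omega_1=\frac{z+\lambda_1}{w}\,dz,\qquad \omega_2=i\,\frac{z+\lambda_2}{w}\,dz,\qquad \omega_3=dz$$ are holomorphic on $X'$ (after the holomorphic extension of $\omega_1,\omega_2$ to the points with $w=0$) and meromorphic at $p$, and all their periods on $X'$ are purely imaginary. Hence $f=\operatorname{Re}\int(\omega_1,\omega_2,\omega_3)$ is a well-defined map $f:X'\to\mathbb R^3$, and its coordinate functions are harmonic. 2. The end at $p$ is of type $(2,2,3)$. That is, $(2,2,3)$ is the lexicographically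 smallest among all triples $n_1\le n_2\le n_3$ that are the pole orders at $p$ of the coordinate forms of $A\circ f$ for some invertible real affine map $A$ of $\mathbb R^3$. (A form without a pole at $p$ has pole order $0$.) 3. $f$ is a proper embedding of $X'$ into $\mathbb R^3$: a smooth immersion, a homeomorphism onto its image, and a proper map. 4. The metric induced by $f$ on $X'$ is complete: every path $[0,\infty)\to X'$ that eventually leaves each compact subset of $X'$ has infinite length. -/

import Mathlib

open scoped Manifold ContDiff Topology

noncomputable section

/-- Euclidean three-space. -/
abbrev E3 : Type := EuclideanSpace ℝ (Fin 3)

section Forms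

/-- A complex-linear 1-form on the complex curve `X`, without any regularity assumption:
a covector at each point. -/
abbrev OneForm (X : Type) [TopologicalSpace X] [ChartedSpace ℂ X] : Type :=
  ∀ x : X, TangentSpace 𝓘(ℂ) x →L[ℂ] ℂ

variable {X : Type} [TopologicalSpace X] [ChartedSpace ℂ X]

/-- The differential `dg` of a complex-valued function. -/
def differential (g : X → ℂ) : OneForm X := fun x => mfderiv 𝓘(ℂ) 𝓘(ℂ) g x

/-- The coefficient `h` of the 1-form `η = h(ζ) dζ` in the chart `ζ` of `X` at `c`. -/
def OneForm.coeff (η : OneForm X) (c : X) (ζ : ℂ) : ℂ :=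
  η ((chartAt ℂ c).symm ζ) (mfderiv 𝓘(ℂ) 𝓘(ℂ) (chartAt ℂ c).symm ζ (1 : ℂ))

/-- `η` is holomorphic near the point `x`. -/
def OneForm.IsHolomorphicAt (η : OneForm X) (x : X) : Prop :=
  AnalyticAt ℂ (η.coeff x) (chartAt ℂ x x)

/-- `η` is meromorphic at the point `x` (its value at `x` itself is irrelevant). -/
def OneForm.IsMeromorphicAt (η : OneForm X) (x : X) : Prop :=
  MeromorphicAt (η.coeff x) (chartAt ℂ x x)

/-- The pole order at `x` of a 1-form which is meromorphic at `x`; it is `0` if there is no pole. -/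
def OneForm.poleOrder (η : OneForm X) (x : X) : ℕ :=
  (-(meromorphicOrderAt (η.coeff x) (chartAt ℂ x x)).untop₀).toNat

/-- The triple of 1-forms of `A ∘ f`, when `Ω` is the triple of 1-forms of `f` and `A` is a
real affine transformation with linear part `A`. -/
def transformForms (A : Matrix (Fin 3) (Fin 3) ℝ) (Ω : Fin 3 → OneForm X) : Fin 3 → OneForm X :=
  fun i x => ∑ j, (A i j : ℂ) • Ω j x

/-- `(n₀, n₁, n₂)` is the type of the end at `p` defined by the triple `Ω` of 1-forms which are
meromorphic at `p`: it is the lexicographically smallest among the nondecreasing triples of pole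
orders of the ends that are affinely equivalent to the given one. -/
def IsEndType (Ω : Fin 3 → OneForm X) (p : X) (n : Fin 3 → ℕ) : Prop :=
  IsLeast {m : Lex (Fin 3 → ℕ) | Monotone (ofLex m) ∧ ∃ A : Matrix (Fin 3) (Fin 3) ℝ,
    IsUnit A.det ∧ ∀ i, (transformForms A Ω i).poleOrder p = ofLex m i} (toLex n)

end Forms

section Surfaces

/-- `X` is a compact (connected, Hausdorff) Riemann surface. -/
structure IsCompactRiemannSurface (X : Type) [TopologicalSpace X] [ChartedSpace ℂ X] : Prop where
  isManifold : IsManifold 𝓘(ℂ) ω X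
  t2 : T2Space X
  compact : CompactSpace X
  connected : ConnectedSpace X

/-- `X` is a compact Riemann surface that is topologically a torus, i.e. of genus one. -/
structure IsComplexTorus (X : Type) [TopologicalSpace X] [ChartedSpace ℂ X] : Prop
    extends IsCompactRiemannSurface X where
  torus : Nonempty (X ≃ₜ Circle × Circle)

variable {X : Type} [TopologicalSpace X] [ChartedSpace ℂ X]

/-- The integral `∫_γ η` of a 1-form along a path `γ : [a, b] → X`. -/
def pathIntegral (η : OneForm X) (γ : ℝ → X) (a b : ℝ) : ℂ :=
  ∫ t in a..b, η (γ t) (mfderivWithin 𝓘(ℝ, ℝ) 𝓘(ℝ, ℂ) γ (Set.Icc a b) t (1 : ℝ))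

/-- The triple `Ω` consists of meromorphic 1-forms on the compact Riemann surface `X`, holomorphic
outside the finite set `S` of punctures, and `f = Re ∫ Ω` as a (single-valued) map on `X ∖ S`.
The values of `f` on `S` are irrelevant. The last field says in particular that all the periods of
`Ω` on `X ∖ S` are imaginary. -/
structure IsHarmonicSurface (S : Finset X) (Ω : Fin 3 → OneForm X) (f : X → E3) : Prop where
  isCompactRiemannSurface : IsCompactRiemannSurface X
  meromorphic : ∀ i, ∀ p ∈ S, (Ω i).IsMeromorphicAt p
  holomorphic : ∀ i, ∀ x ∉ S, (Ω i).IsHolomorphicAt x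
  eq_integral : ∀ (a b : ℝ) (γ : ℝ → X), a < b →
    ContMDiffOn 𝓘(ℝ, ℝ) 𝓘(ℝ, ℂ) 1 γ (Set.Icc a b) → (∀ t ∈ Set.Icc a b, γ t ∉ S) →
    ∀ i, f (γ b) i - f (γ a) i = (pathIntegral (Ω i) γ a b).re

/-- The coordinate functions of `f` are harmonic on `X ∖ S`. -/
def IsHarmonicOff (S : Finset X) (f : X → E3) : Prop :=
  ∀ x ∉ S, ∀ i, InnerProductSpace.HarmonicAt
    (fun ζ : ℂ => f ((chartAt ℂ x).symm ζ) i) (chartAt ℂ x x)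

/-- `f` is a smooth immersion of the real surface `X ∖ S`. -/
def IsImmersionOff (S : Finset X) (f : X → E3) : Prop :=
  ∀ x ∉ S, ContMDiffAt 𝓘(ℝ, ℂ) 𝓘(ℝ, E3) ∞ f x ∧
    Function.Injective (mfderiv 𝓘(ℝ, ℂ) 𝓘(ℝ, E3) f x)

/-- `f` is a proper embedding of `X ∖ S`: an immersion which is a homeomorphism onto its image,
and a proper map. -/
structure IsProperEmbeddingOff (S : Finset X) (f : X → E3) : Prop where
  immersion : IsImmersionOff S f
  embedding : Topology.IsEmbedding (fun x : {x : X // x ∉ S} => f x)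
  proper : IsProperMap (fun x : {x : X // x ∉ S} => f x)

/-- The metric induced by the immersion `f` on `X ∖ S` is complete: every divergent path in
`X ∖ S`, i.e. one that eventually leaves each compact subset of `X ∖ S`, has infinite length. The
length of a path for the induced metric is the Euclidean length of its image. -/
def IsCompleteOff (S : Finset X) (f : X → E3) : Prop :=
  ∀ γ : ℝ → X, ContinuousOn γ (Set.Ici 0) → (∀ t ∈ Set.Ici (0 : ℝ), γ t ∉ S) →
    (∀ K : Set X, IsCompact K → (∀ x ∈ K, x ∉ S) → ∀ᶠ t in Filter.atTop, γ t ∉ K) →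
    eVariationOn (f ∘ γ) (Set.Ici 0) = ⊤

/-- `(z, w)` identifies `X ∖ {p}` with the affine curve `w² = z (z - 1) (z + 1)` in `ℂ²`: it is a
bijective holomorphic map onto this smooth curve (so it is biholomorphic). -/
structure IsAffineCurveModel (p : X) (z w : X → ℂ) : Prop where
  holomorphic_z : ∀ x, x ≠ p → MDifferentiableAt 𝓘(ℂ) 𝓘(ℂ) z x
  holomorphic_w : ∀ x, x ≠ p → MDifferentiableAt 𝓘(ℂ) 𝓘(ℂ) w x
  bijOn : Set.BijOn (fun x => (z x, w x)) {p}ᶜ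
    {q : ℂ × ℂ | q.2 ^ 2 = q.1 * (q.1 - 1) * (q.1 + 1)}

/-- `Ω = ((z + a) / w, i (z + b) / w, 1) dz` on `X ∖ {p}`. The first two identities are written
without division; where `w = 0` the forms are the holomorphic extensions. -/
structure HasTorusForms (p : X) (z w : X → ℂ) (a b : ℝ) (Ω : Fin 3 → OneForm X) : Prop where
  holomorphic : ∀ i, ∀ x, x ≠ p → (Ω i).IsHolomorphicAt x
  first : ∀ x, x ≠ p → w x • Ω 0 x = (z x + a) • differential z x
  second : ∀ x, x ≠ p → w x • Ω 1 x = (Complex.I * (z x + b)) • differential z x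
  third : ∀ x, x ≠ p → Ω 2 x = differential z x

end Surfaces

end

/-! Uniformize the curve by the square torus ℂ/ℤ[i]. Put e = ℘(1/2) > 0. The symmetry ℘(iu) = -℘(u)
kills g₃, so ℘'² = 4℘(℘² - e²). Hence z = ℘/e and w = ℘'/(2e√e) parametrize the curve, with dz/w =
2√e du.

Let ζ be the Weierstrass zeta function (ζ' = -℘) and η its increment along the period 1, a real
number. Its increment along i is -iη by rotation, so Z(u) = ζ(u) - η·conj u is doubly periodic.
Moreover Re Z = Re(ζ - ηu) and Im Z = Im(ζ + ηu), real and imaginary parts of two holomorphic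
functions. So λ₁ = η/e and λ₂ = -η/e remove the real periods, and f = (-s Re Z, s Im Z, Re ℘/e) with
s = 2/√e.

Embeddedness is reduced to the quarter cell Q = [0,1/2]² without 0, which ℘ maps bijectively onto
the closed lower half-plane. The reflections in the coordinate axes carry Q over the whole torus;
they preserve Re ℘ and flip the signs of Re Z and Im Z. On Q one has Re Z ≥ 0 ≥ Im Z, strictly off
the corresponding mirror lines (`periodicZeta_re_pos`, `periodicZeta_im_neg`), so f determines the
reflected copy of Q. Inside Q, a level set of Re ℘ corresponds to a vertical half-line. For Re ℘ ≥ 0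
a critical point of Re Z in its interior would make (℘ + η)/℘' real, which the cubic equation
forbids (`add_ne_real_mul_of_sq_eq`); by Rolle, Re Z is injective there. The diagonal reflection u ↦
i·conj u exchanges Re Z with -Im Z and treats Re ℘ ≤ 0. The same algebra, with 0 < η < e
(`quasiPeriod_mem`), shows that f is an immersion (`eq_zero_of_forms_eq_zero`).

Properness and completeness follow from the pole of ζ, which makes |Z| tend to infinity at the
puncture. The forms have pole orders 2, 2, 3; a real combination of the first two has leading
coefficient proportional to a + ib, so its order cannot drop. -/

namespace PeriodPair

/-! ### Convergence and derivative of the Weierstrass zeta function. -/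

variable (L : PeriodPair)

/-- The Weierstrass zeta function without its principal part at the origin. -/
noncomputable def weierstrassZetaExcept (z : ℂ) : ℂ :=
  ∑' l : L.lattice, if l.1 = 0 then 0 else (1 / (z - l) + 1 / l + z / l ^ 2)

/-- The three terms combine to s² / (l² (s - l)), which is of order ‖l‖⁻³ and hence summable over a
planar lattice. -/
lemma weierstrassZeta_bound (r : ℝ) (s : ℂ) (hs : ‖s‖ < r) (l : ℂ)
    (h : 2 * r ≤ ‖l‖) :
    ‖1 / (s - l) + 1 / l + s / l ^ 2‖ ≤ 2 * r ^ 2 * ‖l‖ ^ (-3 : ℝ) := by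
  have hr : 0 < r := (norm_nonneg s).trans_lt hs
  have hl : 0 < ‖l‖ := by linarith
  have hl0 : l ≠ 0 := norm_pos_iff.mp hl
  have hsl : ‖l‖ / 2 ≤ ‖s - l‖ := by
    rw [norm_sub_rev]
    exact le_trans (by linarith) (norm_sub_norm_le l s)
  have hsl0 : s - l ≠ 0 := norm_pos_iff.mp (by linarith)
  have e : 1 / (s - l) + 1 / l + s / l ^ 2 = s ^ 2 / (l ^ 2 * (s - l)) := by
    field_simp
    ring
  rw [e, norm_div, norm_mul, norm_pow, norm_pow]
  calc ‖s‖ ^ 2 / (‖l‖ ^ 2 * ‖s - l‖) ≤ r ^ 2 / (‖l‖ ^ 2 * (‖l‖ / 2)) := by gcongr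
    _ = 2 * r ^ 2 / ‖l‖ ^ 3 := by field_simp
    _ = _ := by rw [Real.rpow_neg hl.le, ← div_eq_mul_inv]; norm_cast

lemma hasSumLocallyUniformly_weierstrassZetaExcept :
    HasSumLocallyUniformly
      (fun (l : L.lattice) (z : ℂ) ↦ if l.1 = 0 then 0 else (1 / (z - l) + 1 / l + z / l ^ 2))
      L.weierstrassZetaExcept := by
  refine L.hasSumLocallyUniformly_aux (u := (2 * · ^ 2 * ‖·‖ ^ (-3 : ℝ))) _
    (fun _ _ ↦ (ZLattice.summable_norm_rpow _ _ (by simp; norm_num)).mul_left _) fun r hr ↦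
    Filter.eventually_atTop.mpr ⟨2 * r, ?_⟩
  rintro _ h s hs l rfl
  split_ifs
  · simpa using! show 0 ≤ 2 * r ^ 2 * (‖↑l‖ ^ 3)⁻¹ by positivity
  · exact weierstrassZeta_bound r s hs l h

lemma hasDerivAt_weierstrassZeta_summand (l : L.lattice) {z : ℂ}
    (hz : z ∈ (L.lattice \ {0} : Set ℂ)ᶜ) :
    HasDerivAt (fun z : ℂ ↦ if l.1 = 0 then 0 else (1 / (z - l) + 1 / l + z / l ^ 2))
      (-if l.1 = 0 then 0 else (1 / (z - l) ^ 2 - 1 / l.1 ^ 2)) z := by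
  split_ifs with hl
  · simpa using hasDerivAt_const z (0 : ℂ)
  · have hzl : z - l ≠ 0 := fun e ↦ hz ⟨by rw [sub_eq_zero.mp e]; exact l.2, by
      rw [sub_eq_zero.mp e]; exact hl⟩
    have h1 : HasDerivAt (fun z : ℂ ↦ 1 / (z - l)) (-1 / (z - l) ^ 2) z := by
      simpa [Function.comp_def, div_eq_mul_inv] using
        (hasDerivAt_inv hzl).comp z ((hasDerivAt_id z).sub_const (l : ℂ))
    convert! (h1.add_const (1 / (l : ℂ))).add ((hasDerivAt_id z).div_const ((l : ℂ) ^ 2)) using 1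
    ring

/-- Locally uniform convergence of holomorphic functions allows termwise differentiation. -/
lemma hasDerivAt_weierstrassZetaExcept {z : ℂ} (hz : z ∈ (L.lattice \ {0} : Set ℂ)ᶜ) :
    HasDerivAt L.weierstrassZetaExcept (-L.weierstrassPExcept 0 z) z := by
  have hd : DifferentiableOn ℂ L.weierstrassZetaExcept (L.lattice \ {0})ᶜ :=
    L.hasSumLocallyUniformly_weierstrassZetaExcept.hasSumLocallyUniformlyOn.differentiableOn
      (.of_forall fun s ↦ .fun_sum fun i hi x hx ↦
        (L.hasDerivAt_weierstrassZeta_summand i hx).differentiableAt.differentiableWithinAt)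
      L.isOpen_compl_lattice_sdiff
  have e : Set.EqOn (deriv L.weierstrassZetaExcept) (fun z ↦ -L.weierstrassPExcept 0 z)
      (L.lattice \ {0})ᶜ := by
    refine ((L.hasSumLocallyUniformly_weierstrassZetaExcept).tendstoLocallyUniformlyOn.deriv
      (.of_forall fun s ↦ .fun_sum fun i hi x hx ↦
        (L.hasDerivAt_weierstrassZeta_summand i hx).differentiableAt.differentiableWithinAt)
      L.isOpen_compl_lattice_sdiff).unique ?_
    refine (L.hasSumLocallyUniformly_weierstrassPExcept 0).neg.tendstoLocallyUniformlyOn.congr ?_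
    intro s x hx
    simp only [Function.comp_apply]
    rw [deriv_fun_sum fun i hi ↦
      (L.hasDerivAt_weierstrassZeta_summand i hx).differentiableAt]
    rw [Pi.neg_apply, Pi.neg_apply, ← Finset.sum_neg_distrib]
    exact Finset.sum_congr rfl fun i hi ↦
      (L.hasDerivAt_weierstrassZeta_summand i hx).deriv.symm
  have e' : deriv L.weierstrassZetaExcept z = -L.weierstrassPExcept 0 z := e hz
  rw [← e']
  exact (hd.differentiableAt (L.isOpen_compl_lattice_sdiff.mem_nhds hz)).hasDerivAt

end PeriodPair

/-! ### The Gaussian lattice and its symmetries. -/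

open Complex ComplexConjugate

/-- The periods `1` and `i` of the square lattice. -/
noncomputable def gaussianPeriods : PeriodPair where
  ω₁ := 1
  ω₂ := I
  indep := by
    rw [LinearIndependent.pair_iff]
    intro s t h
    have h1 := congrArg re h
    have h2 := congrArg im h
    simp at h1 h2
    exact ⟨h1, h2⟩

/-- The Gaussian integers, as a lattice in the complex plane. -/
noncomputable abbrev gaussianLattice : Submodule ℤ ℂ := gaussianPeriods.lattice

local notation "Λ" => gaussianLattice

namespace GaussianLattice

lemma mem_iff {u : ℂ} : u ∈ Λ ↔ ∃ m n : ℤ, (m : ℂ) + n * I = u := by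
  rw [PeriodPair.mem_lattice]
  simp [gaussianPeriods]

lemma mem_iff_re_im {u : ℂ} : u ∈ Λ ↔ (∃ m : ℤ, u.re = m) ∧ ∃ n : ℤ, u.im = n := by
  rw [mem_iff]
  constructor
  · rintro ⟨m, n, rfl⟩
    exact ⟨⟨m, by simp⟩, ⟨n, by simp⟩⟩
  · rintro ⟨⟨m, hm⟩, ⟨n, hn⟩⟩
    exact ⟨m, n, by apply Complex.ext <;> simp [hm, hn]⟩

lemma I_mul_mem_iff {u : ℂ} : I * u ∈ Λ ↔ u ∈ Λ := by
  simp only [mem_iff_re_im, mul_re, mul_im, I_re, I_im, zero_mul, one_mul, zero_sub, zero_add]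
  constructor
  · rintro ⟨⟨m, hm⟩, h⟩
    exact ⟨h, -m, by push_cast; linarith⟩
  · rintro ⟨h, ⟨m, hm⟩⟩
    exact ⟨⟨-m, by push_cast; linarith⟩, h⟩

lemma conj_mem_iff {u : ℂ} : conj u ∈ Λ ↔ u ∈ Λ := by
  simp only [mem_iff_re_im, conj_re, conj_im]
  constructor
  · rintro ⟨h, ⟨m, hm⟩⟩
    exact ⟨h, -m, by push_cast; linarith⟩
  · rintro ⟨h, ⟨m, hm⟩⟩
    exact ⟨h, -m, by push_cast; linarith⟩

lemma one_mem : (1 : ℂ) ∈ Λ := mem_iff.mpr ⟨1, 0, by simp⟩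

/-- Multiplication by `i` on the Gaussian integers. -/
noncomputable def mulI : Λ ≃ Λ where
  toFun l := ⟨I * l, I_mul_mem_iff.mpr l.2⟩
  invFun l := ⟨-(I * l), neg_mem (I_mul_mem_iff.mpr l.2)⟩
  left_inv l := by ext; simp [← mul_assoc]
  right_inv l := by ext; simp [← mul_assoc]

/-- Complex conjugation on the Gaussian integers. -/
noncomputable def conjEquiv : Λ ≃ Λ where
  toFun l := ⟨conj l, conj_mem_iff.mpr l.2⟩
  invFun l := ⟨conj l, conj_mem_iff.mpr l.2⟩
  left_inv l := by ext; simp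
  right_inv l := by ext; simp

lemma isOpen_compl : IsOpen ((Λ : Set ℂ)ᶜ) := gaussianPeriods.isClosed_lattice.isOpen_compl

lemma countable : (Λ : Set ℂ).Countable := by
  refine (Set.countable_range fun p : ℤ × ℤ ↦ (p.1 : ℂ) + p.2 * I).mono ?_
  intro u hu
  obtain ⟨m, n, h⟩ := mem_iff.mp hu
  exact ⟨(m, n), h⟩

lemma isPreconnected_compl : IsPreconnected ((Λ : Set ℂ)ᶜ) := by
  exact (countable.isPathConnected_compl_of_one_lt_rank (by simp)).isConnected.isPreconnected

end GaussianLattice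

open GaussianLattice

/-- The Weierstrass function of the Gaussian lattice. -/
noncomputable def wp (u : ℂ) : ℂ := gaussianPeriods.weierstrassP u

/-- The derivative of the Weierstrass function of the Gaussian lattice. -/
noncomputable def wp' (u : ℂ) : ℂ := gaussianPeriods.derivWeierstrassP u

/-- The Weierstrass zeta function of the Gaussian lattice. -/
noncomputable def wzeta (u : ℂ) : ℂ := u⁻¹ + gaussianPeriods.weierstrassZetaExcept u

/-! ### Behaviour of ℘, ℘' and ζ under sign change, rotation and conjugation. -/

section Symmetries

lemma wp_neg (u : ℂ) : wp (-u) = wp u := gaussianPeriods.weierstrassP_neg u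

lemma wp'_neg (u : ℂ) : wp' (-u) = -wp' u := gaussianPeriods.derivWeierstrassP_neg u

lemma wp_add {l : ℂ} (hl : l ∈ Λ) (u : ℂ) : wp (u + l) = wp u :=
  gaussianPeriods.weierstrassP_add_coe u ⟨l, hl⟩

lemma wp'_add {l : ℂ} (hl : l ∈ Λ) (u : ℂ) : wp' (u + l) = wp' u :=
  gaussianPeriods.derivWeierstrassP_add_coe u ⟨l, hl⟩

/-- Reindexing of the lattice sum by rotation, which preserves the square lattice. -/
lemma wp_I_mul (u : ℂ) : wp (I * u) = -wp u := by
  simp only [wp, PeriodPair.weierstrassP]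
  rw [← mulI.tsum_eq, ← tsum_neg]
  congr with l
  simp only [mulI, Equiv.coe_fn_mk, ← mul_sub, mul_pow, I_sq, neg_one_mul, div_neg]
  ring

lemma wp_conj (u : ℂ) : wp (conj u) = conj (wp u) := by
  simp only [wp, PeriodPair.weierstrassP]
  rw [← conjEquiv.tsum_eq, conj_tsum]
  congr with l
  simp [conjEquiv]

lemma wp'_I_mul (u : ℂ) : wp' (I * u) = I * wp' u := by
  simp only [wp', PeriodPair.derivWeierstrassP]
  rw [← mulI.tsum_eq, mul_neg, ← tsum_mul_left]
  congr with l
  simp only [mulI, Equiv.coe_fn_mk, ← mul_sub, mul_pow, I_pow_three]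
  rw [div_eq_mul_inv, div_eq_mul_inv, neg_mul, inv_neg, mul_inv, inv_I]
  ring

lemma wzeta_neg (u : ℂ) : wzeta (-u) = -wzeta u := by
  simp only [wzeta, PeriodPair.weierstrassZetaExcept]
  rw [← (Equiv.neg _).tsum_eq, neg_add, ← tsum_neg]
  congr
  · simp
  ext l
  have : -u + l.1 = -(u - l) := by ring
  simp only [Equiv.neg_apply, NegMemClass.coe_neg, sub_neg_eq_add, this, neg_eq_zero]
  split_ifs
  · simp
  · simp only [div_neg, neg_sq, neg_div]
    ring

lemma wzeta_I_mul (u : ℂ) : wzeta (I * u) = -(I * wzeta u) := by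
  simp only [wzeta, PeriodPair.weierstrassZetaExcept]
  rw [← mulI.tsum_eq, mul_add, neg_add, ← tsum_mul_left, ← tsum_neg]
  congr
  · simp [mul_comm]
  ext l
  simp only [mulI, Equiv.coe_fn_mk, ← mul_sub, mul_eq_zero, I_ne_zero, false_or, mul_pow, I_sq]
  split_ifs
  · simp
  · simp
    ring

lemma wzeta_conj (u : ℂ) : wzeta (conj u) = conj (wzeta u) := by
  simp only [wzeta, PeriodPair.weierstrassZetaExcept]
  rw [← conjEquiv.tsum_eq, map_add, conj_tsum]
  congr
  · simp
  ext l
  simp [conjEquiv, apply_ite conj]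

end Symmetries

/-! ### Analyticity, derivatives and the pole at the origin. -/

section Derivatives

lemma analyticOnNhd_wp : AnalyticOnNhd ℂ wp (Λ : Set ℂ)ᶜ :=
  gaussianPeriods.analyticOnNhd_weierstrassP

lemma analyticOnNhd_wp' : AnalyticOnNhd ℂ wp' (Λ : Set ℂ)ᶜ :=
  gaussianPeriods.analyticOnNhd_derivWeierstrassP

lemma hasDerivAt_wp {u : ℂ} (hu : u ∉ Λ) : HasDerivAt wp (wp' u) u := by
  have h := (analyticOnNhd_wp u hu).differentiableAt.hasDerivAt
  rwa [show deriv wp u = wp' u from congrFun gaussianPeriods.deriv_weierstrassP u] at h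

lemma continuousAt_wp {u : ℂ} (hu : u ∉ Λ) : ContinuousAt wp u := (hasDerivAt_wp hu).continuousAt

lemma wp_eq_inv_sq_add (u : ℂ) : wp u = (u ^ 2)⁻¹ + gaussianPeriods.weierstrassPExcept 0 u := by
  have := gaussianPeriods.weierstrassPExcept_add 0 u
  simp only [ZeroMemClass.coe_zero, sub_zero] at this
  rw [wp, ← this]
  simp
  ring

lemma hasDerivAt_wzeta {u : ℂ} (hu : u ∉ Λ) : HasDerivAt wzeta (-wp u) u := by
  have h0 : u ≠ 0 := fun h ↦ hu (h ▸ zero_mem _)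
  convert! (hasDerivAt_inv h0).add
    (gaussianPeriods.hasDerivAt_weierstrassZetaExcept (z := u) fun h ↦ hu h.1) using 1
  rw [wp_eq_inv_sq_add]
  ring

lemma continuousAt_wzeta {u : ℂ} (hu : u ∉ Λ) : ContinuousAt wzeta u :=
  (hasDerivAt_wzeta hu).continuousAt

lemma wp_tendsto_cobounded : Filter.Tendsto wp (𝓝[≠] 0) (Bornology.cobounded ℂ) := by
  have h := gaussianPeriods.order_weierstrassP 0 (zero_mem _)
  exact tendsto_cobounded_of_meromorphicOrderAt_neg (by
    rw [show wp = gaussianPeriods.weierstrassP from rfl, h]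
    decide)

end Derivatives

/-! ### The differential equation of ℘. -/

section Differential

lemma wp'_sq_aux {u : ℂ} (hu : u ∉ Λ) :
    wp' u ^ 2 = 4 * wp u ^ 3 - gaussianPeriods.g₂ * wp u - gaussianPeriods.g₃ :=
  gaussianPeriods.derivWeierstrassP_sq u hu

lemma half_notMem : (1 / 2 : ℂ) ∉ Λ := gaussianPeriods.ω₁_div_two_notMem_lattice

/-- Replacing u by iu changes the sign of every term of the equation except g₃. -/
lemma g₃_eq_zero : gaussianPeriods.g₃ = 0 := by
  have h1 := wp'_sq_aux half_notMem
  have h2 := wp'_sq_aux (I_mul_mem_iff.not.mpr half_notMem)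
  rw [wp'_I_mul, wp_I_mul, mul_pow, I_sq] at h2
  linear_combination (h1 + h2) / 2

lemma wp'_sq' {u : ℂ} (hu : u ∉ Λ) :
    wp' u ^ 2 = 4 * wp u ^ 3 - gaussianPeriods.g₂ * wp u := by
  rw [wp'_sq_aux hu, g₃_eq_zero, sub_zero]

end Differential

/-! ### The pair (℘, ℘') separates points modulo the lattice. -/

section Injectivity

lemma eventually_notMem_lattice : ∀ᶠ u in 𝓝[≠] (0 : ℂ), u ∉ Λ := by
  have h := gaussianPeriods.compl_lattice_sdiff_singleton_mem_nhds 0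
  filter_upwards [nhdsWithin_le_nhds h, self_mem_nhdsWithin] with u hu h0 hΛ
  exact hu ⟨hΛ, h0⟩

lemma wp_not_constant (c : ℂ) : ¬ ∀ u ∉ Λ, wp u = c := by
  intro h
  have h1 : ∀ᶠ u in 𝓝[≠] (0 : ℂ), ‖c‖ + 1 ≤ ‖wp u‖ :=
    (tendsto_norm_cobounded_atTop.comp wp_tendsto_cobounded).eventually_ge_atTop _
  obtain ⟨u, hu, hΛ⟩ := (h1.and eventually_notMem_lattice).exists
  rw [h u hΛ] at hu
  linarith

/-- Differentiate the first-order equation and cancel ℘'. The cancellation is legitimate because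
analytic functions on a connected set have no zero divisors and ℘ is not constant. -/
lemma hasDerivAt_wp' {u : ℂ} (hu : u ∉ Λ) :
    HasDerivAt wp' (6 * wp u ^ 2 - gaussianPeriods.g₂ / 2) u := by
  have hd : ∀ x ∈ (Λ : Set ℂ)ᶜ, HasDerivAt wp' (deriv wp' x) x := fun x hx ↦
    (analyticOnNhd_wp' x hx).differentiableAt.hasDerivAt
  have hF : AnalyticOnNhd ℂ (fun x ↦ deriv wp' x - (6 * wp x ^ 2 - gaussianPeriods.g₂ / 2))
      (Λ : Set ℂ)ᶜ := fun x hx ↦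
    (analyticOnNhd_wp' x hx).deriv.sub
      ((analyticAt_const.mul ((analyticOnNhd_wp x hx).pow 2)).sub analyticAt_const)
  have key : ∀ x ∈ (Λ : Set ℂ)ᶜ,
      wp' x * (deriv wp' x - (6 * wp x ^ 2 - gaussianPeriods.g₂ / 2)) = 0 := by
    intro x hx
    have e1 := (hd x hx).pow 2
    have e2 := (((hasDerivAt_wp hx).pow 3).const_mul 4).sub
      ((hasDerivAt_wp hx).const_mul gaussianPeriods.g₂)
    have e3 := e1.unique (e2.congr_of_eventuallyEq (by
      filter_upwards [isOpen_compl.mem_nhds hx] with y hy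
      simpa using wp'_sq' hy))
    simp only [Nat.cast_ofNat, Nat.add_one_sub_one, pow_one] at e3
    linear_combination e3 / 2
  rcases analyticOnNhd_wp'.eq_zero_or_eq_zero_of_mul_eq_zero hF key isPreconnected_compl
    with h | h
  · exfalso
    refine wp_not_constant (wp (1 / 2)) fun x hx ↦ ?_
    exact isOpen_compl.is_const_of_deriv_eq_zero isPreconnected_compl
      (fun y hy ↦ (hasDerivAt_wp hy).differentiableAt.differentiableWithinAt)
      (fun y hy ↦ by rw [(hasDerivAt_wp hy).deriv, h y hy, Pi.zero_apply]) hx half_notMem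
  · have h' := h u hu
    rw [← sub_eq_zero.mp h']
    exact hd u hu

/-- Along real translations (℘, ℘') solves the autonomous system p' = q, q' = 6p² - g₂/2, so equal
initial values give equal solutions. -/
lemma wp_translate_eventually {u v : ℂ} (hu : u ∉ Λ) (hv : v ∉ Λ) (h : wp u = wp v)
    (h' : wp' u = wp' v) : ∀ᶠ t : ℝ in 𝓝 0, wp (u + t) = wp (v + t) := by
  let V : ℂ × ℂ → ℂ × ℂ := fun p ↦ (p.2, 6 * p.1 ^ 2 - gaussianPeriods.g₂ / 2)
  have hV : ContDiffAt ℝ 1 V (wp u, wp' u) := by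
    refine ContDiff.contDiffAt ?_
    fun_prop
  obtain ⟨K, s, hs, hK⟩ := hV.exists_lipschitzOnWith
  have sol : ∀ x ∉ Λ, (wp x, wp' x) = (wp u, wp' u) →
      ∀ᶠ t : ℝ in 𝓝 0, HasDerivAt (fun t : ℝ ↦ (wp (x + t), wp' (x + t)))
        (V (wp (x + t), wp' (x + t))) t ∧ (wp (x + t), wp' (x + t)) ∈ s := by
    intro x hx hxu
    have hc : ContinuousAt (fun t : ℝ ↦ x + (t : ℂ)) 0 := by fun_prop
    have h0 : x + ((0 : ℝ) : ℂ) = x := by simp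
    have hopen : ∀ᶠ t : ℝ in 𝓝 0, x + (t : ℂ) ∈ (Λ : Set ℂ)ᶜ :=
      hc.eventually_mem (isOpen_compl.mem_nhds (by rw [h0]; exact hx))
    have hmem : ∀ᶠ t : ℝ in 𝓝 0, (wp (x + t), wp' (x + t)) ∈ s := by
      have hc1 : ContinuousAt (fun t : ℝ ↦ (wp (x + t), wp' (x + t))) 0 := by
        refine ContinuousAt.prodMk ?_ ?_
        · exact ContinuousAt.comp (f := fun t : ℝ ↦ x + (t : ℂ))
            (by rw [h0]; exact continuousAt_wp hx) hc
        · exact ContinuousAt.comp (f := fun t : ℝ ↦ x + (t : ℂ))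
            (by rw [h0]; exact (hasDerivAt_wp' hx).continuousAt) hc
      exact hc1.eventually_mem (by simpa [h0, hxu] using hs)
    filter_upwards [hopen, hmem] with t ht hts
    refine ⟨?_, hts⟩
    have e : HasDerivAt (fun t : ℝ ↦ x + (t : ℂ)) 1 t := by
      simpa using (ofRealCLM.hasDerivAt (x := t)).const_add x
    refine HasDerivAt.prodMk ?_ ?_
    · simpa [V, Function.comp_def] using
        HasDerivAt.comp (h := fun t : ℝ ↦ x + (t : ℂ)) t (hasDerivAt_wp ht) e
    · simpa [V, Function.comp_def] using
        HasDerivAt.comp (h := fun t : ℝ ↦ x + (t : ℂ)) t (hasDerivAt_wp' ht) e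
  have := ODE_solution_unique_of_eventually (v := fun _ ↦ V) (s := fun _ ↦ s)
    (.of_forall fun _ ↦ hK) (sol u hu rfl) (sol v hv (by rw [h, h'])) (by simp [h, h'])
  filter_upwards [this] with t ht
  exact congrArg Prod.fst ht

/-- By uniqueness for the ODE and the identity theorem, ℘ has the period d = v - u. If d were not in
the lattice, ℘ would be bounded near d, contradicting the pole at 0. -/
theorem sub_mem_of_wp_eq_of_wp'_eq {u v : ℂ} (hu : u ∉ Λ) (hv : v ∉ Λ) (h : wp u = wp v)
    (h' : wp' u = wp' v) : v - u ∈ Λ := by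
  by_contra hd
  set d := v - u with hd_def
  -- The lattice points and their translates by -d. The set is countable, so its complement is
  -- connected.
  set T : Set ℂ := (Λ : Set ℂ) ∪ (fun x ↦ x - d) '' (Λ : Set ℂ)
  have hT : T.Countable := countable.union (countable.image _)
  have hconn : IsPreconnected Tᶜ :=
    (hT.isPathConnected_compl_of_one_lt_rank (by simp)).isConnected.isPreconnected
  have hT1 : ∀ {x}, x ∈ Tᶜ → x ∉ Λ := fun hx h ↦ hx (Or.inl h)
  have hT2 : ∀ {x}, x ∈ Tᶜ → x + d ∉ Λ := fun hx h ↦ hx (Or.inr ⟨_, h, by ring⟩)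
  have hT3 : ∀ {x}, x ∉ Λ → x + d ∉ Λ → x ∈ Tᶜ := by
    rintro x h1 h2 (h | ⟨y, hy, rfl⟩)
    · exact h1 h
    · exact h2 (by simpa using hy)
  have huT : u ∈ Tᶜ := hT3 hu (by simpa [hd_def] using hv)
  have hfreq : ∃ᶠ x in 𝓝[≠] u, wp x = wp (x + d) := by
    have ht : Filter.Tendsto (fun t : ℝ ↦ u + (t : ℂ)) (𝓝[≠] 0) (𝓝[≠] u) := by
      refine tendsto_nhdsWithin_iff.mpr ⟨?_, ?_⟩
      · have : ContinuousAt (fun t : ℝ ↦ u + (t : ℂ)) 0 := by fun_prop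
        have h2 := this.tendsto
        simp only [ofReal_zero, add_zero] at h2
        exact h2.mono_left nhdsWithin_le_nhds
      · filter_upwards [self_mem_nhdsWithin] with t ht
        simpa using ht
    refine ht.frequently (Filter.Eventually.frequently ?_)
    filter_upwards [nhdsWithin_le_nhds (wp_translate_eventually hu hv h h')] with t ht
    rw [ht]
    congr 1
    simp [hd_def]
    ring
  have heq : Set.EqOn wp (fun x ↦ wp (x + d)) Tᶜ :=
    AnalyticOnNhd.eqOn_of_preconnected_of_frequently_eq
      (fun x hx ↦ analyticOnNhd_wp x (hT1 hx))
      (fun x hx ↦ AnalyticAt.fun_comp (analyticOnNhd_wp (x + d) (hT2 hx)) (by fun_prop))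
      hconn huT hfreq
  have hc : ContinuousAt (fun x ↦ wp (x + d)) 0 :=
    ContinuousAt.comp (g := wp) (f := fun x ↦ x + d) (by simpa using continuousAt_wp hd) (by fun_prop)
  have hc0 : ∀ᶠ x in 𝓝[≠] (0 : ℂ), ‖wp (x + d)‖ < ‖wp d‖ + 1 := by
    refine nhdsWithin_le_nhds (hc.norm.eventually_lt_const ?_)
    simp
  have hm : ∀ᶠ x in 𝓝[≠] (0 : ℂ), x + d ∉ Λ := by
    have : ContinuousAt (fun x : ℂ ↦ x + d) 0 := by fun_prop
    exact nhdsWithin_le_nhds (this.eventually_mem (isOpen_compl.mem_nhds (by simpa using hd)))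
  have h1 : ∀ᶠ u in 𝓝[≠] (0 : ℂ), ‖wp d‖ + 1 ≤ ‖wp u‖ :=
    (tendsto_norm_cobounded_atTop.comp wp_tendsto_cobounded).eventually_ge_atTop _
  obtain ⟨x, hx1, hx2, hx3, hx4⟩ :=
    (hc0.and (hm.and (h1.and eventually_notMem_lattice))).exists
  rw [heq (hT3 hx4 hx2)] at hx3
  linarith

theorem sub_mem_or_add_mem_of_wp_eq {u v : ℂ} (hu : u ∉ Λ) (hv : v ∉ Λ) (h : wp u = wp v) :
    v - u ∈ Λ ∨ v + u ∈ Λ := by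
  have hsq : wp' u ^ 2 = wp' v ^ 2 := by rw [wp'_sq' hu, wp'_sq' hv, h]
  rcases sq_eq_sq_iff_eq_or_eq_neg.mp hsq with h' | h'
  · exact Or.inl (sub_mem_of_wp_eq_of_wp'_eq hu hv h h')
  · right
    have := sub_mem_of_wp_eq_of_wp'_eq (neg_mem_iff.not.mpr hu) hv (by rw [wp_neg, h])
      (by rw [wp'_neg, h', neg_neg])
    simpa using this

lemma two_mul_mem_of_wp'_eq_zero {u : ℂ} (hu : u ∉ Λ) (h : wp' u = 0) : 2 * u ∈ Λ := by
  have := sub_mem_of_wp_eq_of_wp'_eq (neg_mem_iff.not.mpr hu) hu (wp_neg u)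
    (by rw [wp'_neg, h, neg_zero])
  simpa [two_mul] using this

lemma wp'_eq_zero_of_two_mul_mem {u : ℂ} (h : 2 * u ∈ Λ) : wp' u = 0 := by
  have h1 := wp'_add h (-u)
  rw [show -u + 2 * u = u by ring, wp'_neg] at h1
  have h2 : 2 * wp' u = 0 := by linear_combination h1
  simpa using h2

end Injectivity

/-! ### ℘ takes every complex value. -/

section Surjectivity

lemma exists_sub_mem_norm_le (u : ℂ) :
    ∃ v : ℂ, u - v ∈ Λ ∧ |v.re| ≤ 1 / 2 ∧ |v.im| ≤ 1 / 2 := by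
  refine ⟨u - (round u.re + round u.im * I), ?_, ?_, ?_⟩
  · exact mem_iff.mpr ⟨round u.re, round u.im, by ring⟩
  · simpa using abs_sub_round u.re
  · simpa using abs_sub_round u.im

lemma eq_of_sub_mem {α : Type*} {F : ℂ → α} (hF : ∀ {l}, l ∈ Λ → ∀ u, F (u + l) = F u) {u v : ℂ}
    (h : u - v ∈ Λ) : F u = F v := by
  have := hF h v
  rwa [add_sub_cancel] at this

lemma notMem_of_sub_mem {u v : ℂ} (h : u - v ∈ Λ) (hu : u ∉ Λ) : v ∉ Λ := fun hv ↦
  hu (by simpa using add_mem h hv)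

/-- The image is open by the open mapping theorem. It is closed because values near a given c are
attained on a compact part of a period cell, away from the pole. Thus it is all of ℂ. -/
theorem wp_surjective (c : ℂ) : ∃ u ∉ Λ, wp u = c := by
  have hopen : IsOpen (wp '' (Λ : Set ℂ)ᶜ) := by
    rcases analyticOnNhd_wp.is_constant_or_isOpen isPreconnected_compl with ⟨c, hc⟩ | h
    · exact absurd hc (wp_not_constant c)
    · exact h _ subset_rfl isOpen_compl
  have hclosed : IsClosed (wp '' (Λ : Set ℂ)ᶜ) := by
    refine isClosed_of_closure_subset fun c hc ↦ ?_
    have h1 : ∀ᶠ u in 𝓝[≠] (0 : ℂ), ‖c‖ + 1 ≤ ‖wp u‖ :=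
      (tendsto_norm_cobounded_atTop.comp wp_tendsto_cobounded).eventually_ge_atTop _
    obtain ⟨ε, hε, hball⟩ := Metric.mem_nhdsWithin_iff.mp h1
    set K : Set ℂ := (Set.Icc (-(1 / 2)) (1 / 2) ×ℂ Set.Icc (-(1 / 2)) (1 / 2)) \ Metric.ball 0 ε
    have hK : IsCompact K := (isCompact_Icc.reProdIm isCompact_Icc).diff Metric.isOpen_ball
    have hKΛ : ∀ v ∈ K, v ∉ Λ := by
      rintro v ⟨hv, hv0⟩ hΛ
      obtain ⟨⟨m, hm⟩, ⟨n, hn⟩⟩ := mem_iff_re_im.mp hΛ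
      rw [mem_reProdIm, hm, hn] at hv
      have hm0 : m = 0 := by
        have h1 : (-1 : ℝ) < m := by linarith [hv.1.1]
        have h2 : (m : ℝ) < 1 := by linarith [hv.1.2]
        norm_cast at h1 h2
        lia
      have hn0 : n = 0 := by
        have h1 : (-1 : ℝ) < n := by linarith [hv.2.1]
        have h2 : (n : ℝ) < 1 := by linarith [hv.2.2]
        norm_cast at h1 h2
        lia
      have : v = 0 := Complex.ext (by simp [hm, hm0]) (by simp [hn, hn0])
      exact hv0 (by simpa [this] using hε)
    have hcl : IsClosed (wp '' K) := (hK.image_of_continuousOn fun v hv ↦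
      (continuousAt_wp (hKΛ v hv)).continuousWithinAt).isClosed
    have hsub : wp '' (Λ : Set ℂ)ᶜ ∩ Metric.ball c 1 ⊆ wp '' K := by
      rintro _ ⟨⟨u, hu, rfl⟩, hb⟩
      obtain ⟨v, huv, hv1, hv2⟩ := exists_sub_mem_norm_le u
      have hv : v ∉ Λ := notMem_of_sub_mem huv hu
      have hval : wp u = wp v := eq_of_sub_mem wp_add huv
      refine ⟨v, ⟨⟨abs_le.mp hv1, abs_le.mp hv2⟩, fun hvb ↦ ?_⟩, hval.symm⟩
      have hge : ‖c‖ + 1 ≤ ‖wp v‖ := hball ⟨hvb, fun h0 ↦ hv (by rw [h0]; exact zero_mem _)⟩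
      rw [← hval] at hge
      have hlt : ‖wp u - c‖ < 1 := by simpa [dist_eq_norm] using hb
      have := norm_sub_norm_le (wp u) c
      linarith
    have hc' : c ∈ closure (wp '' (Λ : Set ℂ)ᶜ ∩ Metric.ball c 1) :=
      mem_closure_iff_nhds.mpr fun t ht ↦ by
        obtain ⟨y, hy1, hy2⟩ := mem_closure_iff_nhds.mp hc _
          (Filter.inter_mem ht (Metric.ball_mem_nhds c one_pos))
        exact ⟨y, hy1.1, hy2, hy1.2⟩
    obtain ⟨v, hv, rfl⟩ := hcl.closure_subset_iff.mpr hsub hc'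
    exact ⟨v, hKΛ v hv, rfl⟩
  have huniv : wp '' (Λ : Set ℂ)ᶜ = Set.univ :=
    IsClopen.eq_univ ⟨hclosed, hopen⟩ ⟨_, 1 / 2, half_notMem, rfl⟩
  obtain ⟨u, hu, h⟩ := huniv.symm ▸ Set.mem_univ c
  exact ⟨u, hu, h⟩

end Surjectivity

/-! ### The quarter cell. -/

section Square

/-- The closed square `[0, 1/2]²` without the origin. -/
def closedSquare : Set ℂ := (Set.Icc 0 (1 / 2) ×ℂ Set.Icc 0 (1 / 2)) \ {0}

/-- The open square `(0, 1/2)²`. -/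
def openSquare : Set ℂ := Set.Ioo 0 (1 / 2) ×ℂ Set.Ioo 0 (1 / 2)

lemma mem_closedSquare {u : ℂ} : u ∈ closedSquare ↔
    (0 ≤ u.re ∧ u.re ≤ 1 / 2) ∧ (0 ≤ u.im ∧ u.im ≤ 1 / 2) ∧ u ≠ 0 := by
  simp only [closedSquare, Set.mem_sdiff, mem_reProdIm, Set.mem_Icc, Set.mem_singleton_iff,
    and_assoc, ne_eq]

lemma mem_openSquare {u : ℂ} : u ∈ openSquare ↔
    (0 < u.re ∧ u.re < 1 / 2) ∧ (0 < u.im ∧ u.im < 1 / 2) := by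
  simp only [openSquare, mem_reProdIm, Set.mem_Ioo]

lemma isOpen_openSquare : IsOpen openSquare := isOpen_Ioo.reProdIm isOpen_Ioo

lemma isPreconnected_openSquare : IsPreconnected openSquare :=
  by
  have : Convex ℝ openSquare := ((convex_Ioo (0 : ℝ) (1 / 2)).linear_preimage reLm).inter
    ((convex_Ioo (0 : ℝ) (1 / 2)).linear_preimage imLm)
  exact this.isPreconnected

lemma openSquare_subset : openSquare ⊆ closedSquare := fun u hu ↦ by
  rw [mem_openSquare] at hu
  rw [mem_closedSquare]
  refine ⟨⟨hu.1.1.le, hu.1.2.le⟩, ⟨hu.2.1.le, hu.2.2.le⟩, fun h ↦ ?_⟩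
  simp [h] at hu

lemma eq_zero_of_intCast_mem {x : ℝ} {m : ℤ} (h : x = m) (h1 : -1 < x) (h2 : x < 1) : m = 0 := by
  rw [h] at h1 h2
  norm_cast at h1 h2
  lia

lemma notMem_of_mem_closedSquare {u : ℂ} (hu : u ∈ closedSquare) : u ∉ Λ := fun h ↦ by
  rw [mem_closedSquare] at hu
  obtain ⟨⟨m, hm⟩, ⟨n, hn⟩⟩ := mem_iff_re_im.mp h
  have hm0 := eq_zero_of_intCast_mem hm (by linarith) (by linarith)
  have hn0 := eq_zero_of_intCast_mem hn (by linarith) (by linarith)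
  exact hu.2.2 (Complex.ext (by simp [hm, hm0]) (by simp [hn, hn0]))

lemma swap_mem_closedSquare {u : ℂ} (hu : u ∈ closedSquare) : I * conj u ∈ closedSquare := by
  rw [mem_closedSquare] at hu ⊢
  simp only [mul_re, mul_im, I_re, I_im, conj_re, conj_im, ne_eq, mul_eq_zero, I_ne_zero,
    map_eq_zero, false_or, zero_mul, one_mul, zero_sub, neg_neg, zero_add]
  exact ⟨hu.2.1, hu.1, hu.2.2⟩

lemma mem_openSquare_or {u : ℂ} (hu : u ∈ closedSquare) :
    u ∈ openSquare ∨ (u.re = 0 ∨ u.re = 1 / 2) ∨ (u.im = 0 ∨ u.im = 1 / 2) := by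
  rw [mem_closedSquare] at hu
  rw [mem_openSquare]
  by_contra! h
  have h1 := h.1 ⟨lt_of_le_of_ne hu.1.1 (Ne.symm h.2.1.1), lt_of_le_of_ne hu.1.2 h.2.1.2⟩
    (lt_of_le_of_ne hu.2.1.1 (Ne.symm h.2.2.1))
  exact h.2.2.2 (le_antisymm hu.2.1.2 h1)

/-- After translation to the centred unit cell, q has the absolute values of the coordinates, and
the signs ε and δ record the reflection. -/
lemma exists_mem_closedSquare {u : ℂ} (hu : u ∉ Λ) : ∃ q ∈ closedSquare, ∃ ε δ : ℝ,
    (ε = 1 ∨ ε = -1) ∧ (δ = 1 ∨ δ = -1) ∧ u - (⟨ε * q.re, δ * q.im⟩ : ℂ) ∈ Λ := by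
  obtain ⟨v, huv, hv1, hv2⟩ := exists_sub_mem_norm_le u
  have hv := notMem_of_sub_mem huv hu
  have key : ∀ x : ℝ, ∃ ε : ℝ, (ε = 1 ∨ ε = -1) ∧ x = ε * |x| := fun x ↦ by
    rcases abs_cases x with h | h
    · exact ⟨1, Or.inl rfl, by linarith⟩
    · exact ⟨-1, Or.inr rfl, by linarith⟩
  obtain ⟨ε, hε, h1⟩ := key v.re
  obtain ⟨δ, hδ, h2⟩ := key v.im
  refine ⟨⟨|v.re|, |v.im|⟩, mem_closedSquare.mpr ⟨⟨abs_nonneg _, hv1⟩, ⟨abs_nonneg _, hv2⟩, ?_⟩,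
    ε, δ, hε, hδ, ?_⟩
  · intro h
    have h3 := congrArg re h
    have h4 := congrArg im h
    simp at h3 h4
    exact hv ((Complex.ext (by simpa using h3) (by simpa using h4) : v = 0) ▸ zero_mem _)
  · simp only
    rw [← h1, ← h2]
    exact huv

end Square

/-! ### ℘ as a bijection from the quarter cell to the closed lower half-plane. -/

section Values

lemma center_notMem : (⟨1 / 2, 1 / 2⟩ : ℂ) ∉ Λ :=
  notMem_of_mem_closedSquare (mem_closedSquare.mpr (by norm_num [Complex.ext_iff]))

/-- Rotation by i fixes the centre of the cell modulo the lattice, but negates ℘. -/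
lemma wp_center : wp ⟨1 / 2, 1 / 2⟩ = 0 := by
  have h1 := wp_I_mul ⟨1 / 2, 1 / 2⟩
  have h2 := wp_add one_mem (I * ⟨1 / 2, 1 / 2⟩)
  rw [show I * (⟨1 / 2, 1 / 2⟩ : ℂ) + 1 = ⟨1 / 2, 1 / 2⟩ by
    apply Complex.ext <;> simp; norm_num] at h2
  have : 2 * wp ⟨1 / 2, 1 / 2⟩ = 0 := by linear_combination h1 + h2
  simpa using this

lemma wp_swap (u : ℂ) : wp (I * conj u) = -conj (wp u) := by rw [wp_I_mul, wp_conj]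

/-- A real value means ℘(conj u) = ℘(u), that is, conj u ≡ ±u modulo the lattice. -/
lemma wp_im_eq_zero_iff {u : ℂ} (hu : u ∉ Λ) :
    (wp u).im = 0 ↔ (∃ n : ℤ, 2 * u.im = n) ∨ ∃ m : ℤ, 2 * u.re = m := by
  rw [← conj_eq_iff_im, ← wp_conj]
  constructor
  · intro h
    rcases sub_mem_or_add_mem_of_wp_eq hu (conj_mem_iff.not.mpr hu) h.symm with h | h
    · obtain ⟨-, n, hn⟩ := mem_iff_re_im.mp h
      simp only [sub_im, conj_im] at hn
      exact Or.inl ⟨-n, by push_cast; linarith⟩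
    · obtain ⟨⟨n, hn⟩, -⟩ := mem_iff_re_im.mp h
      simp only [add_re, conj_re] at hn
      exact Or.inr ⟨n, by linarith⟩
  · rintro (⟨n, hn⟩ | ⟨n, hn⟩)
    · refine eq_of_sub_mem wp_add (mem_iff_re_im.mpr ⟨⟨0, by simp⟩, -n, ?_⟩)
      simp
      linarith
    · rw [← wp_neg u]
      refine eq_of_sub_mem wp_add (mem_iff_re_im.mpr ⟨⟨n, ?_⟩, 0, by simp⟩)
      simp
      linarith

lemma wp_im_ne_zero {u : ℂ} (hu : u ∈ openSquare) : (wp u).im ≠ 0 := by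
  rw [Ne, wp_im_eq_zero_iff (notMem_of_mem_closedSquare (openSquare_subset hu))]
  rw [mem_openSquare] at hu
  rintro (⟨n, hn⟩ | ⟨n, hn⟩)
  · have := eq_zero_of_intCast_mem hn (by linarith) (by linarith)
    rw [this, Int.cast_zero] at hn
    linarith
  · have := eq_zero_of_intCast_mem hn (by linarith) (by linarith)
    rw [this, Int.cast_zero] at hn
    linarith

lemma tendsto_sq_mul_wp : Filter.Tendsto (fun u ↦ u ^ 2 * wp u) (𝓝[≠] 0) (𝓝 1) := by
  have hc : ContinuousAt (gaussianPeriods.weierstrassPExcept 0) 0 :=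
    (gaussianPeriods.analyticAt_weierstrassPExcept 0).continuousAt
  have h : ContinuousAt (fun u : ℂ ↦ 1 + u ^ 2 * gaussianPeriods.weierstrassPExcept 0 u) 0 :=
    continuousAt_const.add ((continuousAt_id.pow 2).mul hc)
  have h1 := h.tendsto.mono_left (nhdsWithin_le_nhds (s := {0}ᶜ))
  simp only [ne_eq, OfNat.ofNat_ne_zero, not_false_eq_true, zero_pow, zero_mul, add_zero] at h1
  refine h1.congr' ?_
  filter_upwards [self_mem_nhdsWithin] with u hu
  have hu : u ≠ 0 := hu
  rw [wp_eq_inv_sq_add]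
  field_simp

lemma tendsto_ofReal_mul {v : ℂ} (hv : v ≠ 0) :
    Filter.Tendsto (fun t : ℝ ↦ (t : ℂ) * v) (𝓝[>] 0) (𝓝[≠] 0) := by
  refine tendsto_nhdsWithin_iff.mpr ⟨?_, ?_⟩
  · have : ContinuousAt (fun t : ℝ ↦ (t : ℂ) * v) 0 := by fun_prop
    have h := this.tendsto.mono_left (nhdsWithin_le_nhds (s := Set.Ioi 0))
    simpa using h
  · filter_upwards [self_mem_nhdsWithin] with t ht
    simpa [hv] using (show (0 : ℝ) < t from ht).ne'

/-- Near 0, ℘(u) behaves like u⁻². This gives the sign of ℘ at one point of a region, from which it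
spreads by connectedness. -/
lemma eventually_wp_ray {v : ℂ} (hv : v ≠ 0) : ∀ᶠ t : ℝ in 𝓝[>] 0, 0 < (v ^ 2 * wp (t * v)).re := by
  have h := (tendsto_sq_mul_wp.comp (tendsto_ofReal_mul hv))
  have h2 : ∀ᶠ t : ℝ in 𝓝[>] 0, 0 < (((t : ℂ) * v) ^ 2 * wp (t * v)).re :=
    ((continuous_re.tendsto _).comp h).eventually_const_lt (by simp)
  filter_upwards [h2, self_mem_nhdsWithin] with t ht ht0
  have ht0 : 0 < t := ht0
  rw [mul_pow, mul_assoc, ← ofReal_pow, re_ofReal_mul] at ht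
  exact (mul_pos_iff_of_pos_left (by positivity)).mp ht

lemma neg_of_isPreconnected {X : Type*} [TopologicalSpace X] {s : Set X} (hs : IsPreconnected s)
    {f : X → ℝ} (hf : ContinuousOn f s) (h0 : ∀ x ∈ s, f x ≠ 0) {x y : X} (hx : x ∈ s)
    (hfx : f x < 0) (hy : y ∈ s) : f y < 0 := by
  by_contra! h
  obtain ⟨z, hz, hz0⟩ := hs.intermediate_value hx hy hf ⟨hfx.le, h⟩
  exact h0 z hz hz0

/-- Im ℘ has no zero in the connected open square, so its sign is that near 0 on the diagonal, where
u⁻² is a positive multiple of -i. -/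
lemma wp_im_neg {u : ℂ} (hu : u ∈ openSquare) : (wp u).im < 0 := by
  have h1 : ∀ᶠ t : ℝ in 𝓝[>] 0, t < 1 / 2 :=
    nhdsWithin_le_nhds (eventually_lt_nhds (by norm_num))
  have hv : (1 + I : ℂ) ≠ 0 := fun h ↦ by simpa using congrArg re h
  obtain ⟨t, ht, ht1, ht0⟩ := ((eventually_wp_ray hv).and (h1.and self_mem_nhdsWithin)).exists
  have ht0 : 0 < t := ht0
  refine neg_of_isPreconnected (f := fun u ↦ (wp u).im) isPreconnected_openSquare ?_
    (fun u hu ↦ wp_im_ne_zero hu) (x := t * (1 + I)) ?_ ?_ hu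
  · exact fun u hu ↦ (continuous_im.continuousAt.comp (continuousAt_wp
      (notMem_of_mem_closedSquare (openSquare_subset hu)))).continuousWithinAt
  · rw [mem_openSquare]
    simp [ht0]
    linarith
  · rw [show (1 + I) ^ 2 = 2 * I by linear_combination I_sq] at ht
    simp at ht
    linarith

lemma ofReal_mem_closedSquare {x : ℝ} (h0 : 0 < x) (h1 : x ≤ 1 / 2) : (x : ℂ) ∈ closedSquare := by
  rw [mem_closedSquare]
  simp only [ofReal_re, ofReal_im, ne_eq, ofReal_eq_zero]
  exact ⟨⟨h0.le, h1⟩, by norm_num, h0.ne'⟩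

lemma wp_ofReal_im (x : ℝ) : (wp x).im = 0 := by
  rw [← conj_eq_iff_im, ← wp_conj, conj_ofReal]

/-- ℘ is positive near 0 on the real axis, and a zero would have to be congruent to the centre of
the cell up to sign. -/
lemma wp_ofReal_pos {x : ℝ} (h0 : 0 < x) (h1 : x ≤ 1 / 2) : 0 < (wp x).re := by
  have h2 : ∀ᶠ t : ℝ in 𝓝[>] 0, t < 1 / 2 :=
    nhdsWithin_le_nhds (eventually_lt_nhds (by norm_num))
  obtain ⟨t, ht, ht1, ht0⟩ :=
    ((eventually_wp_ray one_ne_zero).and (h2.and self_mem_nhdsWithin)).exists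
  simp only [one_pow, mul_one, one_mul] at ht
  have hneg := neg_of_isPreconnected (f := fun x : ℝ ↦ -(wp x).re)
    (isPreconnected_Ioc (a := 0) (b := 1 / 2)) ?_ ?_ (x := t) ⟨ht0, ht1.le⟩ (by linarith) ⟨h0, h1⟩
  · linarith
  · intro y hy
    have : ContinuousAt (fun y : ℝ ↦ wp y) y := ContinuousAt.comp (g := wp)
      (continuousAt_wp (notMem_of_mem_closedSquare (ofReal_mem_closedSquare hy.1 hy.2)))
      (by fun_prop)
    exact (continuous_re.continuousAt.comp this).neg.continuousWithinAt
  · intro y hy h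
    have hy0 : wp y = wp ⟨1 / 2, 1 / 2⟩ := by
      rw [wp_center]
      exact Complex.ext (by simpa using h) (by simpa using wp_ofReal_im y)
    have hyΛ := notMem_of_mem_closedSquare (ofReal_mem_closedSquare hy.1 hy.2)
    rcases sub_mem_or_add_mem_of_wp_eq hyΛ center_notMem hy0 with h | h
    all_goals
      obtain ⟨-, n, hn⟩ := mem_iff_re_im.mp h
      simp at hn
      have := eq_zero_of_intCast_mem hn (by norm_num) (by norm_num)
      simp [this] at hn

/-- The value of the Weierstrass function at `1/2`. -/
noncomputable def wpHalf : ℝ := (wp (1 / 2)).re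

lemma wp_half : wp (1 / 2) = wpHalf := by
  have := wp_ofReal_im (1 / 2)
  exact Complex.ext (by simp [wpHalf]) (by simpa using this)

lemma wpHalf_pos : 0 < wpHalf := by
  have := wp_ofReal_pos (x := 1 / 2) (by norm_num) le_rfl
  simpa [wpHalf] using this

/-- ℘' vanishes at the half-period 1/2. -/
lemma g₂_eq : gaussianPeriods.g₂ = 4 * (wpHalf : ℂ) ^ 2 := by
  have h := wp'_sq' half_notMem
  rw [wp'_eq_zero_of_two_mul_mem (by simpa using one_mem), wp_half] at h
  have h0 : (wpHalf : ℂ) ≠ 0 := ofReal_ne_zero.mpr wpHalf_pos.ne'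
  refine mul_right_cancel₀ h0 ?_
  linear_combination h

lemma wp'_sq {u : ℂ} (hu : u ∉ Λ) : wp' u ^ 2 = 4 * (wp u * (wp u ^ 2 - (wpHalf : ℂ) ^ 2)) := by
  rw [wp'_sq' hu, g₂_eq]
  ring

lemma wp_injOn_closedSquare : Set.InjOn wp closedSquare := by
  intro u hu v hv h
  have huΛ := notMem_of_mem_closedSquare hu
  have hvΛ := notMem_of_mem_closedSquare hv
  rw [mem_closedSquare] at hu hv
  rcases sub_mem_or_add_mem_of_wp_eq huΛ hvΛ h with h | h
  · obtain ⟨⟨m, hm⟩, ⟨n, hn⟩⟩ := mem_iff_re_im.mp h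
    have hm0 := eq_zero_of_intCast_mem hm (by simp; linarith) (by simp; linarith)
    have hn0 := eq_zero_of_intCast_mem hn (by simp; linarith) (by simp; linarith)
    simp [hm0, hn0] at hm hn
    exact Complex.ext (by linarith) (by linarith)
  · have key : ∀ {x y : ℝ} {m : ℤ}, x + y = m → 0 ≤ x → x ≤ 1 / 2 → 0 ≤ y → y ≤ 1 / 2 → y = x := by
      intro x y m h h1 h2 h3 h4
      rcases eq_or_ne (x + y) 1 with h5 | h5
      · linarith
      · have := eq_zero_of_intCast_mem h (by linarith) (lt_of_le_of_ne (by linarith) h5)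
        rw [this, Int.cast_zero] at h
        linarith
    obtain ⟨⟨m, hm⟩, ⟨n, hn⟩⟩ := mem_iff_re_im.mp h
    exact Complex.ext (key hm hv.1.1 hv.1.2 hu.1.1 hu.1.2)
      (key hn hv.2.1.1 hv.2.1.2 hu.2.1.1 hu.2.1.2)

lemma wp_im_eq_zero_of_edge {u : ℂ} (hu : u ∉ Λ)
    (h : (u.re = 0 ∨ u.re = 1 / 2) ∨ (u.im = 0 ∨ u.im = 1 / 2)) : (wp u).im = 0 := by
  rw [wp_im_eq_zero_iff hu]
  rcases h with (h | h) | (h | h)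
  · exact Or.inr ⟨0, by simp [h]⟩
  · exact Or.inr ⟨1, by simp [h]⟩
  · exact Or.inl ⟨0, by simp [h]⟩
  · exact Or.inl ⟨1, by simp [h]⟩

lemma wp_im_nonpos {u : ℂ} (hu : u ∈ closedSquare) : (wp u).im ≤ 0 := by
  rcases mem_openSquare_or hu with h | h
  · exact (wp_im_neg h).le
  · exact (wp_im_eq_zero_of_edge (notMem_of_mem_closedSquare hu) h).le

/-- Reflecting a preimage into the quarter cell replaces c at most by its conjugate. Both values
then lie in the closed lower half-plane, so in that case c is real and nothing changes. -/
lemma exists_wp_eq {c : ℂ} (hc : c.im ≤ 0) : ∃ u ∈ closedSquare, wp u = c := by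
  obtain ⟨u, hu, rfl⟩ := wp_surjective c
  obtain ⟨q, hq, ε, δ, hε, hδ, h⟩ := exists_mem_closedSquare hu
  refine ⟨q, hq, ?_⟩
  have hq' := wp_im_nonpos hq
  rw [eq_of_sub_mem wp_add h] at hc ⊢
  have e1 : (⟨q.re, q.im⟩ : ℂ) = q := rfl
  have e2 : (⟨q.re, -q.im⟩ : ℂ) = conj q := rfl
  have e3 : (⟨-q.re, q.im⟩ : ℂ) = -conj q := by apply Complex.ext <;> simp
  have e4 : (⟨-q.re, -q.im⟩ : ℂ) = -q := by apply Complex.ext <;> simp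
  have hconj : (conj (wp q)).im ≤ 0 → wp q = conj (wp q) := fun h ↦ by
    rw [conj_im] at h
    exact (conj_eq_iff_im.mpr (by linarith)).symm
  rcases hε with rfl | rfl <;> rcases hδ with rfl | rfl
  · simp only [one_mul, e1]
  · simp only [one_mul, neg_mul, e2, wp_conj] at hc ⊢
    exact hconj hc
  · simp only [one_mul, neg_mul, e3, wp_neg, wp_conj] at hc ⊢
    exact hconj hc
  · simp only [one_mul, neg_mul, e4, wp_neg]

end Values

/-! ### The quasi-period and the doubly periodic function Z = ζ - η·conj u. -/

section QuasiPeriod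

/-- The period of the Weierstrass zeta function along `1`. -/
noncomputable def quasiPeriod : ℝ := 2 * (wzeta (1 / 2)).re

lemma wzeta_half : wzeta (1 / 2) = quasiPeriod / 2 := by
  have h : (wzeta (1 / 2)).im = 0 := by
    rw [← conj_eq_iff_im, ← wzeta_conj]
    simp [show conj (2 : ℂ) = 2 from conj_ofNat 2]
  apply Complex.ext <;> simp [quasiPeriod]
  simpa using h

/-- The increment has derivative zero on a connected set; at -1/2 oddness evaluates it as 2ζ(1/2).
-/
lemma wzeta_add_one {u : ℂ} (hu : u ∉ Λ) : wzeta (u + 1) = wzeta u + quasiPeriod := by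
  have hmem : ∀ {x}, x ∉ Λ → x + 1 ∉ Λ := fun hx h ↦ hx (by simpa using sub_mem h one_mem)
  have hd : ∀ x ∈ (Λ : Set ℂ)ᶜ, HasDerivAt (fun x ↦ wzeta (x + 1) - wzeta x) 0 x := by
    intro x hx
    have h1 : HasDerivAt (fun x ↦ wzeta (x + 1)) (-wp (x + 1)) x := by
      simpa using (hasDerivAt_wzeta (hmem hx)).comp_add_const x 1
    convert! h1.sub (hasDerivAt_wzeta hx) using 1
    rw [wp_add one_mem]
    ring
  have h := isOpen_compl.is_const_of_deriv_eq_zero isPreconnected_compl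
      (fun y hy ↦ (hd y hy).differentiableAt.differentiableWithinAt)
      (fun y hy ↦ (hd y hy).deriv) (x := u) (y := -(1 / 2)) hu (neg_mem_iff.not.mpr half_notMem)
  rw [wzeta_neg, show -(1 / 2 : ℂ) + 1 = 1 / 2 by norm_num, wzeta_half] at h
  linear_combination h

/-- The doubly periodic combination of the Weierstrass zeta function and complex conjugation,
set to zero at the poles. -/
noncomputable def periodicZeta (u : ℂ) : ℂ :=
  open Classical in if u ∈ Λ then 0 else wzeta u - quasiPeriod * conj u

lemma periodicZeta_of_notMem {u : ℂ} (hu : u ∉ Λ) :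
    periodicZeta u = wzeta u - quasiPeriod * conj u := if_neg hu

lemma periodicZeta_of_mem {u : ℂ} (hu : u ∈ Λ) : periodicZeta u = 0 := if_pos hu

lemma periodicZeta_neg (u : ℂ) : periodicZeta (-u) = -periodicZeta u := by
  by_cases hu : u ∈ Λ
  · rw [periodicZeta_of_mem hu, periodicZeta_of_mem (neg_mem hu), neg_zero]
  · rw [periodicZeta_of_notMem hu, periodicZeta_of_notMem (neg_mem_iff.not.mpr hu), wzeta_neg,
      map_neg]
    ring

lemma periodicZeta_I_mul (u : ℂ) : periodicZeta (I * u) = -(I * periodicZeta u) := by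
  by_cases hu : u ∈ Λ
  · rw [periodicZeta_of_mem hu, periodicZeta_of_mem (I_mul_mem_iff.mpr hu), mul_zero, neg_zero]
  · rw [periodicZeta_of_notMem hu, periodicZeta_of_notMem (I_mul_mem_iff.not.mpr hu),
      wzeta_I_mul, map_mul, conj_I]
    ring

lemma periodicZeta_conj (u : ℂ) : periodicZeta (conj u) = conj (periodicZeta u) := by
  by_cases hu : u ∈ Λ
  · rw [periodicZeta_of_mem hu, periodicZeta_of_mem (conj_mem_iff.mpr hu), map_zero]
  · rw [periodicZeta_of_notMem hu, periodicZeta_of_notMem (conj_mem_iff.not.mpr hu),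
      wzeta_conj, map_sub, map_mul, conj_ofReal]

lemma periodicZeta_swap (u : ℂ) : periodicZeta (I * conj u) = -(I * conj (periodicZeta u)) := by
  rw [periodicZeta_I_mul, periodicZeta_conj]

lemma periodicZeta_add_one (u : ℂ) : periodicZeta (u + 1) = periodicZeta u := by
  by_cases hu : u ∈ Λ
  · rw [periodicZeta_of_mem hu, periodicZeta_of_mem (add_mem hu one_mem)]
  · have hu' : u + 1 ∉ Λ := fun h ↦ hu (by simpa using sub_mem h one_mem)
    rw [periodicZeta_of_notMem hu, periodicZeta_of_notMem hu', wzeta_add_one hu, map_add, map_one]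
    ring

/-- The rotation by i carries the period 1 to the period i, so one real constant corrects both
quasi-periods. -/
lemma periodicZeta_add_I (u : ℂ) : periodicZeta (u + I) = periodicZeta u := by
  have h := periodicZeta_I_mul (-(I * u) + 1)
  rw [show I * (-(I * u) + 1) = u + I by linear_combination (-u) * I_mul_I,
    periodicZeta_add_one, periodicZeta_neg, periodicZeta_I_mul] at h
  rw [h]
  linear_combination (-periodicZeta u) * I_mul_I

lemma periodicZeta_add {l : ℂ} (hl : l ∈ Λ) (u : ℂ) : periodicZeta (u + l) = periodicZeta u := by
  obtain ⟨m, n, rfl⟩ := mem_iff.mp hl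
  have h1 : Function.Periodic periodicZeta (m * 1) := Function.Periodic.int_mul periodicZeta_add_one m
  have h2 : Function.Periodic periodicZeta (n * I) := Function.Periodic.int_mul periodicZeta_add_I n
  rw [mul_one] at h1
  exact (h1.add_period h2) u

/-- These lines are fixed modulo the lattice by the reflection u ↦ -conj u, which negates Re Z. -/
lemma periodicZeta_re_eq_zero {u : ℂ} {n : ℤ} (h : 2 * u.re = n) : (periodicZeta u).re = 0 := by
  have h1 : periodicZeta u = periodicZeta (-conj u) := by
    refine eq_of_sub_mem periodicZeta_add (mem_iff_re_im.mpr ⟨⟨n, ?_⟩, 0, by simp⟩)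
    simp
    linarith
  rw [periodicZeta_neg, periodicZeta_conj] at h1
  have h2 := congrArg re h1
  simp at h2
  linarith

lemma periodicZeta_im_eq_zero {u : ℂ} {n : ℤ} (h : 2 * u.im = n) : (periodicZeta u).im = 0 := by
  have h1 : periodicZeta u = periodicZeta (conj u) := by
    refine eq_of_sub_mem periodicZeta_add (mem_iff_re_im.mpr ⟨⟨0, by simp⟩, n, ?_⟩)
    simp
    linarith
  rw [periodicZeta_conj] at h1
  have h2 := congrArg im h1
  simp at h2
  linarith

/-- Although Z is not holomorphic, this and the next lemma write its two components as parts of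
holomorphic functions, with derivatives -(℘ + η) and -(℘ - η). -/
lemma periodicZeta_re {u : ℂ} (hu : u ∉ Λ) :
    (periodicZeta u).re = (wzeta u - quasiPeriod * u).re := by
  simp [periodicZeta_of_notMem hu]

lemma periodicZeta_im {u : ℂ} (hu : u ∉ Λ) :
    (periodicZeta u).im = (wzeta u + quasiPeriod * u).im := by
  simp [periodicZeta_of_notMem hu]

lemma continuousAt_periodicZeta {u : ℂ} (hu : u ∉ Λ) : ContinuousAt periodicZeta u := by
  have h : ContinuousAt (fun u ↦ wzeta u - quasiPeriod * conj u) u :=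
    (continuousAt_wzeta hu).sub (by fun_prop)
  refine h.congr ?_
  filter_upwards [isOpen_compl.mem_nhds hu] with x hx
  exact (periodicZeta_of_notMem hx).symm

lemma hasDerivAt_wzeta_sub {u : ℂ} (hu : u ∉ Λ) :
    HasDerivAt (fun u ↦ wzeta u - quasiPeriod * u) (-(wp u + quasiPeriod)) u := by
  convert! (hasDerivAt_wzeta hu).sub ((hasDerivAt_id u).const_mul (quasiPeriod : ℂ)) using 1
  ring

lemma hasDerivAt_wzeta_add {u : ℂ} (hu : u ∉ Λ) :
    HasDerivAt (fun u ↦ wzeta u + quasiPeriod * u) (-(wp u - quasiPeriod)) u := by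
  convert! (hasDerivAt_wzeta hu).add ((hasDerivAt_id u).const_mul (quasiPeriod : ℂ)) using 1
  ring

/-- The chain rule along a real curve. -/
lemma hasDerivAt_periodicZeta_re_comp {c : ℝ → ℂ} {c' : ℂ} {t : ℝ} (hu : c t ∉ Λ)
    (hc : HasDerivAt c c' t) :
    HasDerivAt (fun t ↦ (periodicZeta (c t)).re) (-((wp (c t) + quasiPeriod) * c')).re t := by
  have h := (reCLM.hasFDerivAt.comp_hasDerivAt t ((hasDerivAt_wzeta_sub hu).comp t hc))
  rw [neg_mul] at h
  refine h.congr_of_eventuallyEq ?_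
  filter_upwards [hc.continuousAt.eventually_mem (isOpen_compl.mem_nhds hu)] with s hs
  exact periodicZeta_re hs

lemma hasDerivAt_periodicZeta_im_comp {c : ℝ → ℂ} {c' : ℂ} {t : ℝ} (hu : c t ∉ Λ)
    (hc : HasDerivAt c c' t) :
    HasDerivAt (fun t ↦ (periodicZeta (c t)).im) (-((wp (c t) - quasiPeriod) * c')).im t := by
  have h := (imCLM.hasFDerivAt.comp_hasDerivAt t ((hasDerivAt_wzeta_add hu).comp t hc))
  rw [neg_mul] at h
  refine h.congr_of_eventuallyEq ?_
  filter_upwards [hc.continuousAt.eventually_mem (isOpen_compl.mem_nhds hu)] with s hs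
  exact periodicZeta_im hs

end QuasiPeriod

/-! ### Z on the edges of the quarter cell, and the bounds 0 < η < e. -/

section Edges

lemma edge_mem {y : ℝ} (h0 : 0 ≤ y) (h1 : y ≤ 1 / 2) : (⟨1 / 2, y⟩ : ℂ) ∈ closedSquare :=
  mem_closedSquare.mpr ⟨⟨by norm_num, le_rfl⟩, ⟨h0, h1⟩, fun h ↦ by
    have := congrArg re h
    norm_num at this⟩

lemma hasDerivAt_edge (y : ℝ) : HasDerivAt (fun y : ℝ ↦ (⟨1 / 2, y⟩ : ℂ)) I y := by
  have h : HasDerivAt (fun y : ℝ ↦ (1 / 2 : ℂ) + y * I) I y := by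
    simpa using ((ofRealCLM.hasDerivAt (x := y)).mul_const I).const_add (1 / 2 : ℂ)
  convert! h using 2
  apply Complex.ext <;> simp

lemma wp_edge_im {y : ℝ} (h0 : 0 ≤ y) (h1 : y ≤ 1 / 2) : (wp ⟨1 / 2, y⟩).im = 0 :=
  wp_im_eq_zero_of_edge (notMem_of_mem_closedSquare (edge_mem h0 h1)) (Or.inl (Or.inr rfl))

/-- A continuous injective real function on an interval is monotone; the end values e > 0 and 0
decide the direction. -/
lemma wp_edge_strictAntiOn :
    StrictAntiOn (fun y : ℝ ↦ (wp ⟨1 / 2, y⟩).re) (Set.Icc 0 (1 / 2)) := by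
  have hcont : ContinuousOn (fun y : ℝ ↦ (wp ⟨1 / 2, y⟩).re) (Set.Icc 0 (1 / 2)) := fun y hy ↦
    (continuous_re.continuousAt.comp (ContinuousAt.comp (g := wp)
      (continuousAt_wp (notMem_of_mem_closedSquare (edge_mem hy.1 hy.2)))
      (hasDerivAt_edge y).continuousAt)).continuousWithinAt
  have hinj : Set.InjOn (fun y : ℝ ↦ (wp ⟨1 / 2, y⟩).re) (Set.Icc 0 (1 / 2)) := by
    intro x hx y hy h
    have := wp_injOn_closedSquare (edge_mem hx.1 hx.2) (edge_mem hy.1 hy.2)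
      (Complex.ext h (by rw [wp_edge_im hx.1 hx.2, wp_edge_im hy.1 hy.2]))
    exact congrArg im this
  rcases hcont.strictMonoOn_of_injOn_Icc' (by norm_num) hinj with h | h
  · exfalso
    have h1 := h (Set.left_mem_Icc.mpr (by norm_num)) (Set.right_mem_Icc.mpr (by norm_num))
      (by norm_num)
    have h2 : (⟨1 / 2, 0⟩ : ℂ) = 1 / 2 := by apply Complex.ext <;> simp
    simp only [wp_center, h2, wp_half, ofReal_re, zero_re] at h1
    exact absurd h1 wpHalf_pos.le.not_gt
  · exact h

lemma continuousOn_edge_im :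
    ContinuousOn (fun y : ℝ ↦ (periodicZeta ⟨1 / 2, y⟩).im) (Set.Icc 0 (1 / 2)) := fun y hy ↦
  (hasDerivAt_periodicZeta_im_comp (notMem_of_mem_closedSquare (edge_mem hy.1 hy.2))
    (hasDerivAt_edge y)).continuousAt.continuousWithinAt

lemma hasDerivAt_edge_im {y : ℝ} (h0 : 0 ≤ y) (h1 : y ≤ 1 / 2) :
    HasDerivAt (fun y : ℝ ↦ (periodicZeta ⟨1 / 2, y⟩).im)
      (quasiPeriod - (wp ⟨1 / 2, y⟩).re) y := by
  have := hasDerivAt_periodicZeta_im_comp (notMem_of_mem_closedSquare (edge_mem h0 h1))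
    (hasDerivAt_edge y)
  simpa using this

lemma edge_im_zero : (periodicZeta ⟨1 / 2, 0⟩).im = 0 :=
  periodicZeta_im_eq_zero (n := 0) (by simp)

lemma edge_im_half : (periodicZeta ⟨1 / 2, 1 / 2⟩).im = 0 :=
  periodicZeta_im_eq_zero (n := 1) (by simp)

/-- Im Z vanishes at both ends of the right edge and has derivative η - ℘ along it. By Rolle, η is a
value of ℘ inside that edge, hence strictly between the end values 0 and e. -/
lemma quasiPeriod_mem : 0 < quasiPeriod ∧ quasiPeriod < wpHalf := by
  obtain ⟨y, hy, h⟩ := exists_hasDerivAt_eq_zero (show (0 : ℝ) < 1 / 2 by norm_num)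
    continuousOn_edge_im (by rw [edge_im_zero, edge_im_half])
    fun y hy ↦ hasDerivAt_edge_im hy.1.le hy.2.le
  have h1 := wp_edge_strictAntiOn (Set.left_mem_Icc.mpr (by norm_num)) ⟨hy.1.le, hy.2.le⟩ hy.1
  have h2 := wp_edge_strictAntiOn ⟨hy.1.le, hy.2.le⟩ (Set.right_mem_Icc.mpr (by norm_num)) hy.2
  have h3 : (⟨1 / 2, 0⟩ : ℂ) = 1 / 2 := by apply Complex.ext <;> simp
  simp only [wp_center, h3, wp_half, ofReal_re, zero_re] at h1 h2
  constructor <;> linarith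

/-- The derivative η - ℘ is strictly increasing, so Im Z is strictly convex on the edge and vanishes
at its ends. -/
lemma edge_im_neg {y : ℝ} (h0 : 0 < y) (h1 : y < 1 / 2) : (periodicZeta ⟨1 / 2, y⟩).im < 0 := by
  have hconv : StrictConvexOn ℝ (Set.Icc 0 (1 / 2))
      (fun y : ℝ ↦ (periodicZeta ⟨1 / 2, y⟩).im) := by
    refine StrictMonoOn.strictConvexOn_of_deriv (convex_Icc _ _) continuousOn_edge_im ?_
    rw [interior_Icc]
    intro x hx y hy hxy
    rw [(hasDerivAt_edge_im hx.1.le hx.2.le).deriv, (hasDerivAt_edge_im hy.1.le hy.2.le).deriv]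
    have := wp_edge_strictAntiOn (Set.Ioo_subset_Icc_self hx) (Set.Ioo_subset_Icc_self hy) hxy
    simp only at this
    linarith
  obtain ⟨-, h⟩ := hconv
  -- The weights 1 - 2y and 2y write y as a convex combination of 0 and 1/2.
  replace h := h (Set.left_mem_Icc.mpr (by norm_num)) (Set.right_mem_Icc.mpr (by norm_num))
    (by norm_num) (show 0 < 1 - 2 * y by linarith) (show 0 < 2 * y by linarith) (by ring)
  have e : (1 - 2 * y) • (0 : ℝ) + (2 * y) • (1 / 2 : ℝ) = y := by
    simp only [smul_eq_mul]
    ring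
  rw [e] at h
  simpa only [edge_im_zero, edge_im_half, smul_eq_mul, mul_zero, add_zero] using h

/-- Re Z decreases strictly, with derivative -(℘ + η) < 0, to its value 0 at 1/2. -/
lemma bottom_re_pos {x : ℝ} (h0 : 0 < x) (h1 : x < 1 / 2) : 0 < (periodicZeta x).re := by
  have hd : ∀ y : ℝ, 0 < y → y ≤ 1 / 2 → HasDerivAt (fun y : ℝ ↦ (periodicZeta y).re)
      (-((wp y).re + quasiPeriod)) y := by
    intro y hy0 hy1
    simpa using hasDerivAt_periodicZeta_re_comp
      (notMem_of_mem_closedSquare (ofReal_mem_closedSquare hy0 hy1)) ofRealCLM.hasDerivAt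
  have hanti : StrictAntiOn (fun y : ℝ ↦ (periodicZeta y).re) (Set.Icc x (1 / 2)) := by
    refine strictAntiOn_of_deriv_neg (convex_Icc _ _) (fun y hy ↦
      (hd y (h0.trans_le hy.1) hy.2).continuousAt.continuousWithinAt) fun y hy ↦ ?_
    rw [interior_Icc] at hy
    rw [(hd y (h0.trans hy.1) hy.2.le).deriv]
    have := wp_ofReal_pos (h0.trans hy.1) hy.2.le
    linarith [quasiPeriod_mem.1]
  have h := hanti (Set.left_mem_Icc.mpr h1.le) (Set.right_mem_Icc.mpr h1.le) h1
  have hz : (periodicZeta ((1 / 2 : ℝ) : ℂ)).re = 0 := periodicZeta_re_eq_zero (n := 1) (by simp)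
  simp only [hz] at h
  exact h

end Edges

/-! ### Signs of Re Z and Im Z on the quarter cell. -/

section Sign

/-- Re Z is Re(1/u) ≥ 0 plus a function continuous and zero at the origin. This bound replaces a
boundary value at the removed corner. -/
lemma exists_re_gt {m : ℝ} (hm : m < 0) :
    ∃ ε > 0, ∀ u ∈ closedSquare, ‖u‖ < ε → m < (periodicZeta u).re := by
  have hc : ContinuousAt (fun u ↦ (gaussianPeriods.weierstrassZetaExcept u - quasiPeriod * u).re)
      0 := continuous_re.continuousAt.comp
    ((gaussianPeriods.hasDerivAt_weierstrassZetaExcept (z := 0) (by simp)).continuousAt.sub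
      (by fun_prop))
  have h0 : gaussianPeriods.weierstrassZetaExcept 0 = 0 := by
    simp [PeriodPair.weierstrassZetaExcept]
  obtain ⟨ε, hε, h⟩ := Metric.eventually_nhds_iff.mp (hc.eventually_const_lt (by simpa [h0] using hm))
  refine ⟨ε, hε, fun u hu hn ↦ ?_⟩
  have h1 := h (y := u) (by simpa using hn)
  have h2 : 0 ≤ (u⁻¹).re := by
    rw [inv_re]
    exact div_nonneg (mem_closedSquare.mp hu).1.1 (normSq_nonneg u)
  rw [periodicZeta_re (notMem_of_mem_closedSquare hu), wzeta, add_sub_assoc, add_re]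
  linarith

/-- A critical point would require ℘ = -η, but ℘ is not real in the open square. -/
lemma not_isLocalMin_re {u : ℂ} (hu : u ∈ openSquare) :
    ¬ IsLocalMin (fun u ↦ (periodicZeta u).re) u := by
  intro h
  have huΛ := notMem_of_mem_closedSquare (openSquare_subset hu)
  -- The direction of steepest descent: the derivative of Re Z along v is -|℘ + η|².
  set v : ℂ := conj (wp u + quasiPeriod)
  have hc : HasDerivAt (fun t : ℝ ↦ u + t * v) v 0 := by
    simpa using ((ofRealCLM.hasDerivAt (x := 0)).mul_const v).const_add u
  have h0 : u + ((0 : ℝ) : ℂ) * v = u := by simp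
  have hd := hasDerivAt_periodicZeta_re_comp (c := fun t : ℝ ↦ u + t * v) (by simpa using huΛ) hc
  have hmin : IsLocalMin (fun t : ℝ ↦ (periodicZeta (u + t * v)).re) 0 := by
    have h1 : IsLocalMin (fun u ↦ (periodicZeta u).re) (u + ((0 : ℝ) : ℂ) * v) := by rwa [h0]
    exact h1.comp_continuous (f := fun u ↦ (periodicZeta u).re) (g := fun t : ℝ ↦ u + t * v)
      hc.continuousAt
  have hz := hmin.hasDerivAt_eq_zero hd
  simp only [h0] at hz
  rw [neg_re, neg_eq_zero, mul_conj, ofReal_re, normSq_eq_zero] at hz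
  have h2 := congrArg im hz
  simp at h2
  exact (wp_im_neg hu).ne h2

lemma periodicZeta_edge_re {u : ℂ} (hu : u ∈ closedSquare) (hu' : u ∉ openSquare) :
    0 ≤ (periodicZeta u).re ∧ (u.re ≠ 0 → u.re ≠ 1 / 2 → 0 < (periodicZeta u).re) := by
  rcases (mem_openSquare_or hu).resolve_left hu' with (h | h) | h
  · exact ⟨(periodicZeta_re_eq_zero (n := 0) (by simp [h])).ge, fun h1 ↦ absurd h h1⟩
  · exact ⟨(periodicZeta_re_eq_zero (n := 1) (by simp [h])).ge, fun _ h1 ↦ absurd h h1⟩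
  · have key : u.re ≠ 0 → u.re ≠ 1 / 2 → 0 < (periodicZeta u).re := by
      intro h0 h1
      have hx0 := lt_of_le_of_ne (mem_closedSquare.mp hu).1.1 (Ne.symm h0)
      have hx1 := lt_of_le_of_ne (mem_closedSquare.mp hu).1.2 h1
      rcases h with h | h
      · have hu : u = (u.re : ℂ) := Complex.ext (by simp) (by simpa using h)
        rw [hu]
        exact bottom_re_pos hx0 hx1
      -- The diagonal reflection carries the top edge to the right edge and Re Z to -Im Z.
      · have h2 := edge_im_neg hx0 hx1
        have hu : (⟨1 / 2, u.re⟩ : ℂ) = I * conj u := by apply Complex.ext <;> simp [h]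
        rw [hu, periodicZeta_swap] at h2
        simpa using h2
    refine ⟨?_, key⟩
    by_cases h0 : u.re = 0
    · exact (periodicZeta_re_eq_zero (n := 0) (by simp [h0])).ge
    by_cases h1 : u.re = 1 / 2
    · exact (periodicZeta_re_eq_zero (n := 1) (by simp [h1])).ge
    exact (key h0 h1).le

/-- Minimum principle on the square minus a small ball: a negative minimum could lie neither on an
edge, nor near the corner 0, nor in the interior. -/
lemma periodicZeta_re_nonneg {u : ℂ} (hu : u ∈ closedSquare) : 0 ≤ (periodicZeta u).re := by
  by_contra! hneg
  obtain ⟨ε, hε, hsmall⟩ := exists_re_gt hneg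
  set K : Set ℂ := (Set.Icc 0 (1 / 2) ×ℂ Set.Icc 0 (1 / 2)) \ Metric.ball 0 ε
  have hK : IsCompact K := (isCompact_Icc.reProdIm isCompact_Icc).diff Metric.isOpen_ball
  have hKS : ∀ v ∈ K, v ∈ closedSquare := by
    rintro v ⟨hv, hv0⟩
    refine ⟨hv, ?_⟩
    rintro rfl
    exact hv0 (by simpa using hε)
  have hSK : ∀ v ∈ closedSquare, ε ≤ ‖v‖ → v ∈ K := fun v hv h ↦
    ⟨hv.1, by simpa using h⟩
  have huK : u ∈ K := hSK u hu (by
    by_contra! h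
    exact lt_irrefl _ (hsmall u hu h))
  obtain ⟨v, hv, hmin⟩ := hK.exists_isMinOn ⟨u, huK⟩ (f := fun u ↦ (periodicZeta u).re)
    fun w hw ↦ (continuous_re.continuousAt.comp (continuousAt_periodicZeta
      (notMem_of_mem_closedSquare (hKS w hw)))).continuousWithinAt
  have hvu : (periodicZeta v).re ≤ (periodicZeta u).re := hmin huK
  have hvo : v ∈ openSquare := by
    by_contra h
    linarith [(periodicZeta_edge_re (hKS v hv) h).1]
  refine not_isLocalMin_re hvo ?_
  filter_upwards [isOpen_openSquare.mem_nhds hvo] with w hw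
  rcases lt_or_ge ‖w‖ ε with h | h
  · exact hvu.trans (hsmall w (openSquare_subset hw) h).le
  · exact hmin (hSK w (openSquare_subset hw) h)

lemma periodicZeta_re_pos {u : ℂ} (hu : u ∈ closedSquare) (h0 : u.re ≠ 0) (h1 : u.re ≠ 1 / 2) :
    0 < (periodicZeta u).re := by
  by_cases ho : u ∈ openSquare
  · refine lt_of_le_of_ne (periodicZeta_re_nonneg hu) fun h ↦ not_isLocalMin_re ho ?_
    filter_upwards [isOpen_openSquare.mem_nhds ho] with w hw
    rw [← h]
    exact periodicZeta_re_nonneg (openSquare_subset hw)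
  · exact (periodicZeta_edge_re hu ho).2 h0 h1

lemma periodicZeta_im_nonpos {u : ℂ} (hu : u ∈ closedSquare) : (periodicZeta u).im ≤ 0 := by
  have h := periodicZeta_re_nonneg (swap_mem_closedSquare hu)
  rw [periodicZeta_swap] at h
  simpa using h

lemma periodicZeta_im_neg {u : ℂ} (hu : u ∈ closedSquare) (h0 : u.im ≠ 0) (h1 : u.im ≠ 1 / 2) :
    (periodicZeta u).im < 0 := by
  have h := periodicZeta_re_pos (swap_mem_closedSquare hu) (by simpa using h0)
    (by simpa using h1)
  rw [periodicZeta_swap] at h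
  simpa using h

end Sign

/-! ### The inequality derived from the cubic equation. -/

section CubicSign

/-- Squaring z + a = r w and multiplying by conj(z + a)·conj(z - e) makes the coefficients on both
sides real. The imaginary parts are then Im z times factors of opposite sign, the left one nonzero.
-/
lemma add_ne_real_mul_of_sq_eq {a e : ℝ} (ha : 0 ≤ a) (he : 0 < e) {z w : ℂ}
    (hw : w ^ 2 = 4 * (z * (z ^ 2 - (e : ℂ) ^ 2))) (hre : 0 ≤ z.re) (him : z.im ≠ 0) (r : ℝ) :
    z + a ≠ r * w := by
  intro h
  have h1 : (z + a) * (z + a) = (4 * r ^ 2 : ℝ) * (z * (z - e) * (z + e)) := by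
    rw [h]
    push_cast
    linear_combination (r : ℂ) ^ 2 * hw
  have h2 : (normSq (z + a) : ℂ) * ((z + a) * conj (z - e)) =
      ((4 * r ^ 2 * normSq (z - e) : ℝ) : ℂ) * (z * conj (z + a) * (z + e)) := by
    rw [ofReal_mul, ← mul_conj, ← mul_conj]
    linear_combination conj (z + a) * conj (z - e) * h1
  have h3 := congrArg im h2
  rw [im_ofReal_mul, im_ofReal_mul] at h3
  simp only [mul_im, mul_re, add_re, add_im, sub_re, sub_im, conj_re, conj_im, ofReal_re,
    ofReal_im, map_add, map_sub, conj_ofReal] at h3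
  have h4 : z.im * (normSq (z + a) * (a + e) +
      4 * r ^ 2 * normSq (z - e) * (z.re ^ 2 + 2 * a * z.re + z.im ^ 2 + a * e)) = 0 := by
    linear_combination -h3
  have h5 : 0 < normSq (z + a) := normSq_pos.mpr fun h ↦ him (by simpa using congrArg im h)
  have h6 := normSq_nonneg (z - e)
  have h7 : 0 < normSq (z + a) * (a + e) := mul_pos h5 (by linarith)
  have h8 : 0 ≤ 4 * r ^ 2 * normSq (z - e) * (z.re ^ 2 + 2 * a * z.re + z.im ^ 2 + a * e) := by
    positivity
  rcases mul_eq_zero.mp h4 with h | h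
  · exact him h
  · linarith

lemma wp_add_ne_real_mul {u : ℂ} (hu : u ∉ Λ) (hre : 0 ≤ (wp u).re) (him : (wp u).im ≠ 0) (r : ℝ) :
    wp u + quasiPeriod ≠ r * wp' u :=
  add_ne_real_mul_of_sq_eq quasiPeriod_mem.1.le wpHalf_pos (wp'_sq hu) hre him r

/-- The cubic equation is invariant under (z, w) ↦ (-z, iw), which turns this into the preceding
case. -/
lemma wp_sub_ne_imag_mul {u : ℂ} (hu : u ∉ Λ) (hre : (wp u).re ≤ 0) (him : (wp u).im ≠ 0) (r : ℝ) :
    wp u - quasiPeriod ≠ r * (I * wp' u) := by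
  intro h
  refine add_ne_real_mul_of_sq_eq (z := -wp u) (w := I * wp' u) quasiPeriod_mem.1.le wpHalf_pos
    ?_ (by simpa using hre) (by simpa using him) (-r) ?_
  · rw [mul_pow, I_sq, wp'_sq hu]
    ring
  · rw [ofReal_neg]
    linear_combination -h

end CubicSign

/-! ### The inverse of ℘ on the closed lower half-plane. -/

section Inverse

/-- The inverse of the Weierstrass function, from the closed lower half-plane to the square. -/
noncomputable def wpInv (c : ℂ) : ℂ :=
  open Classical in if h : c.im ≤ 0 then (exists_wp_eq h).choose else 0

lemma wpInv_mem {c : ℂ} (h : c.im ≤ 0) : wpInv c ∈ closedSquare := by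
  rw [wpInv, dif_pos h]
  exact (exists_wp_eq h).choose_spec.1

lemma wp_wpInv {c : ℂ} (h : c.im ≤ 0) : wp (wpInv c) = c := by
  rw [wpInv, dif_pos h]
  exact (exists_wp_eq h).choose_spec.2

lemma wpInv_wp {u : ℂ} (hu : u ∈ closedSquare) : wpInv (wp u) = u :=
  wp_injOn_closedSquare (wpInv_mem (wp_im_nonpos hu)) hu (wp_wpInv (wp_im_nonpos hu))

/-- Near c the inverse stays in a compact part of the square, away from the pole, and any cluster
point u there satisfies ℘(u) = c, which determines it. -/
lemma continuousWithinAt_wpInv (c : ℂ) :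
    ContinuousWithinAt wpInv {c | c.im ≤ 0} c := by
  have h1 : ∀ᶠ u in 𝓝[≠] (0 : ℂ), ‖c‖ + 1 ≤ ‖wp u‖ :=
    (tendsto_norm_cobounded_atTop.comp wp_tendsto_cobounded).eventually_ge_atTop _
  obtain ⟨ε, hε, hball⟩ := Metric.mem_nhdsWithin_iff.mp h1
  have hK : IsCompact ((Set.Icc 0 (1 / 2) ×ℂ Set.Icc 0 (1 / 2)) \ Metric.ball 0 ε) :=
    (isCompact_Icc.reProdIm isCompact_Icc).diff Metric.isOpen_ball
  have hKS : ∀ v ∈ (Set.Icc 0 (1 / 2) ×ℂ Set.Icc 0 (1 / 2)) \ Metric.ball 0 ε,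
      v ∈ closedSquare := by
    rintro v ⟨hv, hv0⟩
    refine ⟨hv, ?_⟩
    rintro rfl
    exact hv0 (by simpa using hε)
  refine hK.tendsto_nhds_of_unique_mapClusterPt ?_ ?_
  · have h2 : ∀ᶠ d in 𝓝 c, ‖d‖ < ‖c‖ + 1 :=
      continuous_norm.continuousAt.eventually_lt_const (by linarith)
    filter_upwards [nhdsWithin_le_nhds h2, self_mem_nhdsWithin] with d hd hd0
    refine ⟨(wpInv_mem hd0).1, fun hb ↦ ?_⟩
    have h3 : ‖c‖ + 1 ≤ ‖wp (wpInv d)‖ := hball ⟨hb, (wpInv_mem hd0).2⟩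
    rw [wp_wpInv hd0] at h3
    linarith
  · intro u hu hcl
    have huS := hKS u hu
    have h2 := hcl.continuousAt_comp (continuousAt_wp (notMem_of_mem_closedSquare huS))
    have h3 : Filter.Tendsto (wp ∘ wpInv) (𝓝[{c | c.im ≤ 0}] c) (𝓝 c) := by
      refine (Filter.tendsto_id.mono_left nhdsWithin_le_nhds).congr' ?_
      filter_upwards [self_mem_nhdsWithin] with d hd
      exact (wp_wpInv hd).symm
    have h4 : wp u = c := by
      have := ClusterPt.mono h2 h3
      exact eq_of_nhds_neBot this
    rw [← h4, wpInv_wp huS]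

lemma wpInv_mem_openSquare {c : ℂ} (h : c.im < 0) : wpInv c ∈ openSquare :=
  (mem_openSquare_or (wpInv_mem h.le)).resolve_right fun h' ↦ by
    have := wp_im_eq_zero_of_edge (notMem_of_mem_closedSquare (wpInv_mem h.le)) h'
    rw [wp_wpInv h.le] at this
    exact h.ne this

lemma wp'_ne_zero_of_mem_openSquare {u : ℂ} (hu : u ∈ openSquare) : wp' u ≠ 0 := fun h ↦ by
  obtain ⟨⟨m, hm⟩, -⟩ := mem_iff_re_im.mp
    (two_mul_mem_of_wp'_eq_zero (notMem_of_mem_closedSquare (openSquare_subset hu)) h)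
  rw [mem_openSquare] at hu
  simp only [mul_re, re_ofNat, im_ofNat, zero_mul, sub_zero] at hm
  have := eq_zero_of_intCast_mem hm (by linarith) (by linarith)
  rw [this, Int.cast_zero] at hm
  linarith

lemma hasDerivAt_wpInv {c : ℂ} (h : c.im < 0) : HasDerivAt wpInv (wp' (wpInv c))⁻¹ c := by
  have hn : {c : ℂ | c.im ≤ 0} ∈ 𝓝 c := by
    filter_upwards [(isOpen_lt continuous_im continuous_const).mem_nhds h] with d hd
    exact le_of_lt hd
  refine HasDerivAt.of_local_left_inverse ((continuousWithinAt_wpInv c).continuousAt hn)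
    (hasDerivAt_wp (notMem_of_mem_closedSquare (wpInv_mem h.le)))
    (wp'_ne_zero_of_mem_openSquare (wpInv_mem_openSquare h)) ?_
  filter_upwards [hn] with d hd
  exact wp_wpInv hd

end Inverse

/-! ### Injectivity modulo the lattice. -/

section Injective

/-- If the imaginary parts were in the opposite order, Rolle on the vertical segment between the two
values of ℘ would give a zero of the derivative of Re Z, which is -Im((℘ + η)/℘'). The quotient
would then be real, contrary to the cubic inequality. -/
lemma eq_of_re_periodicZeta_eq_aux {u v : ℂ} (hu : u ∈ closedSquare) (hv : v ∈ closedSquare)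
    (h0 : 0 ≤ (wp u).re) (h1 : (wp u).re = (wp v).re) (h2 : (periodicZeta u).re = (periodicZeta v).re) :
    (wp v).im ≤ (wp u).im := by
  by_contra! hlt
  set s := (wp u).re
  set c : ℝ → ℂ := fun t ↦ s - t * I
  have hcre : ∀ t, (c t).re = s := fun t ↦ by simp [c]
  have hcim : ∀ t, (c t).im = -t := fun t ↦ by simp [c]
  have hcu : c (-(wp u).im) = wp u := Complex.ext (by simp [hcre, s]) (by simp [hcim])
  have hcv : c (-(wp v).im) = wp v := Complex.ext (by simp [hcre, h1]) (by simp [hcim])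
  have hc : ∀ t, HasDerivAt c (-I) t := fun t ↦ by
    simpa using ((ofRealCLM.hasDerivAt (x := t)).mul_const I).const_sub (s : ℂ)
  have hv0 := wp_im_nonpos hv
  have hcont : ContinuousOn (fun t ↦ (periodicZeta (wpInv (c t))).re)
      (Set.Icc (-(wp v).im) (-(wp u).im)) := by
    intro t ht
    have ht0 : (c t).im ≤ 0 := by rw [hcim]; linarith [ht.1]
    have hcw : ContinuousWithinAt (fun t ↦ wpInv (c t)) (Set.Icc (-(wp v).im) (-(wp u).im)) t := by
      refine (continuousWithinAt_wpInv _).comp (hc t).continuousAt.continuousWithinAt ?_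
      intro t ht
      simp only [Set.mem_ofPred_eq, hcim]
      linarith [ht.1]
    have hz := (continuousAt_periodicZeta
      (notMem_of_mem_closedSquare (wpInv_mem ht0))).comp_continuousWithinAt_of_eq hcw rfl
    exact continuous_re.continuousAt.comp_continuousWithinAt hz
  obtain ⟨t, ht, hz⟩ := exists_hasDerivAt_eq_zero (show -(wp v).im < -(wp u).im by linarith) hcont
    (by simp only [hcu, hcv, wpInv_wp hu, wpInv_wp hv, h2])
    (f' := fun t ↦ (-((wp (wpInv (c t)) + quasiPeriod) * ((wp' (wpInv (c t)))⁻¹ * -I))).re)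
    (fun t ht ↦ by
      have ht0 : (c t).im < 0 := by rw [hcim]; linarith [ht.1]
      exact hasDerivAt_periodicZeta_re_comp (c := fun t ↦ wpInv (c t))
        (notMem_of_mem_closedSquare (wpInv_mem ht0.le)) ((hasDerivAt_wpInv ht0).comp t (hc t)))
  have ht0 : (c t).im < 0 := by rw [hcim]; linarith [ht.1]
  have hq := wp'_ne_zero_of_mem_openSquare (wpInv_mem_openSquare ht0)
  refine wp_add_ne_real_mul (notMem_of_mem_closedSquare (wpInv_mem ht0.le))
    (by rw [wp_wpInv ht0.le, hcre]; exact h0) (by rw [wp_wpInv ht0.le]; exact ht0.ne)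
    ((wp (wpInv (c t)) + quasiPeriod) * (wp' (wpInv (c t)))⁻¹).re ?_
  have him : ((wp (wpInv (c t)) + quasiPeriod) * (wp' (wpInv (c t)))⁻¹).im = 0 := by
    rw [← mul_assoc, mul_neg, neg_neg, mul_I_re, neg_eq_zero] at hz
    exact hz
  rw [show ((((wp (wpInv (c t)) + quasiPeriod) * (wp' (wpInv (c t)))⁻¹).re : ℝ) : ℂ) =
    (wp (wpInv (c t)) + quasiPeriod) * (wp' (wpInv (c t)))⁻¹ from
      Complex.ext (by simp) (by rw [him]; simp)]
  field_simp

lemma eq_of_re_periodicZeta_eq {u v : ℂ} (hu : u ∈ closedSquare) (hv : v ∈ closedSquare)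
    (h0 : 0 ≤ (wp u).re) (h1 : (wp u).re = (wp v).re)
    (h2 : (periodicZeta u).re = (periodicZeta v).re) : u = v :=
  wp_injOn_closedSquare hu hv (Complex.ext h1 (le_antisymm
    (eq_of_re_periodicZeta_eq_aux hv hu (h1 ▸ h0) h1.symm h2.symm)
    (eq_of_re_periodicZeta_eq_aux hu hv h0 h1 h2)))

/-- For Re ℘ ≤ 0 the diagonal reflection, which negates Re ℘, reduces to the other half. -/
lemma eq_of_periodicZeta_eq_of_mem {u v : ℂ} (hu : u ∈ closedSquare) (hv : v ∈ closedSquare)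
    (h1 : (wp u).re = (wp v).re) (h2 : periodicZeta u = periodicZeta v) : u = v := by
  rcases le_total 0 (wp u).re with h0 | h0
  · exact eq_of_re_periodicZeta_eq hu hv h0 h1 (by rw [h2])
  · have := eq_of_re_periodicZeta_eq (swap_mem_closedSquare hu) (swap_mem_closedSquare hv)
      (by rw [wp_swap]; simpa using h0) (by simp [wp_swap, h1])
      (by simp only [periodicZeta_swap, h2])
    exact (starRingEnd ℂ).injective (mul_left_cancel₀ I_ne_zero this)

lemma wp_reflect_re (q : ℂ) {ε δ : ℝ} (hε : ε = 1 ∨ ε = -1) (hδ : δ = 1 ∨ δ = -1) :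
    (wp ⟨ε * q.re, δ * q.im⟩).re = (wp q).re := by
  have e1 : (⟨q.re, q.im⟩ : ℂ) = q := rfl
  have e2 : (⟨q.re, -q.im⟩ : ℂ) = conj q := rfl
  have e3 : (⟨-q.re, q.im⟩ : ℂ) = -conj q := by apply Complex.ext <;> simp
  have e4 : (⟨-q.re, -q.im⟩ : ℂ) = -q := by apply Complex.ext <;> simp
  rcases hε with rfl | rfl <;> rcases hδ with rfl | rfl <;>
    simp only [one_mul, neg_mul, e1, e2, e3, e4, wp_neg, wp_conj, conj_re]

lemma periodicZeta_reflect (q : ℂ) {ε δ : ℝ} (hε : ε = 1 ∨ ε = -1) (hδ : δ = 1 ∨ δ = -1) :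
    periodicZeta ⟨ε * q.re, δ * q.im⟩ = ⟨ε * (periodicZeta q).re, δ * (periodicZeta q).im⟩ := by
  have e1 : (⟨q.re, q.im⟩ : ℂ) = q := rfl
  have e2 : (⟨q.re, -q.im⟩ : ℂ) = conj q := rfl
  have e3 : (⟨-q.re, q.im⟩ : ℂ) = -conj q := by apply Complex.ext <;> simp
  have e4 : (⟨-q.re, -q.im⟩ : ℂ) = -q := by apply Complex.ext <;> simp
  rcases hε with rfl | rfl <;> rcases hδ with rfl | rfl <;>
    simp only [one_mul, neg_mul, e1, e2, e3, e4, periodicZeta_neg, periodicZeta_conj] <;>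
    apply Complex.ext <;> simp

lemma sign_mul_eq {ε ε' x y : ℝ} (hε : ε = 1 ∨ ε = -1) (hε' : ε' = 1 ∨ ε' = -1) (hx : 0 ≤ x)
    (hy : 0 ≤ y) (h : ε * x = ε' * y) : x = y ∧ (ε = ε' ∨ x = 0) := by
  rcases hε with rfl | rfl <;> rcases hε' with rfl | rfl
  · exact ⟨by linarith, Or.inl rfl⟩
  · exact ⟨by linarith, Or.inr (by linarith)⟩
  · exact ⟨by linarith, Or.inr (by linarith)⟩
  · exact ⟨by linarith, Or.inl rfl⟩

lemma exists_int_sub {ε ε' x : ℝ} (hε : ε = 1 ∨ ε = -1) (hε' : ε' = 1 ∨ ε' = -1)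
    (h : ε = ε' ∨ x = 0 ∨ x = 1 / 2) : ∃ n : ℤ, ε * x - ε' * x = n := by
  rcases h with rfl | rfl | rfl
  · exact ⟨0, by simp⟩
  · exact ⟨0, by simp⟩
  · rcases hε with rfl | rfl <;> rcases hε' with rfl | rfl
    · exact ⟨0, by norm_num⟩
    · exact ⟨1, by norm_num⟩
    · exact ⟨-1, by norm_num⟩
    · exact ⟨0, by norm_num⟩

/-- Both points are reflections of points of the quarter cell. The known signs of Z there identify
the absolute values of its components, hence the two representatives; the reflections can differ
only across a mirror line, where they agree modulo the lattice. -/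
theorem sub_mem_of_periodicZeta_eq {u v : ℂ} (hu : u ∉ Λ) (hv : v ∉ Λ)
    (h1 : (wp u).re = (wp v).re) (h2 : periodicZeta u = periodicZeta v) : u - v ∈ Λ := by
  obtain ⟨q, hq, ε, δ, hε, hδ, hqu⟩ := exists_mem_closedSquare hu
  obtain ⟨p, hp, ε', δ', hε', hδ', hpv⟩ := exists_mem_closedSquare hv
  rw [eq_of_sub_mem wp_add hqu, eq_of_sub_mem wp_add hpv, wp_reflect_re q hε hδ,
    wp_reflect_re p hε' hδ'] at h1
  rw [eq_of_sub_mem periodicZeta_add hqu, eq_of_sub_mem periodicZeta_add hpv,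
    periodicZeta_reflect q hε hδ, periodicZeta_reflect p hε' hδ'] at h2
  obtain ⟨hre, hre'⟩ := sign_mul_eq hε hε' (periodicZeta_re_nonneg hq) (periodicZeta_re_nonneg hp)
    (congrArg re h2)
  obtain ⟨him, him'⟩ := sign_mul_eq hδ hδ' (neg_nonneg.mpr (periodicZeta_im_nonpos hq))
    (neg_nonneg.mpr (periodicZeta_im_nonpos hp)) (by simpa using congrArg im h2)
  have hqp : q = p :=
    eq_of_periodicZeta_eq_of_mem hq hp h1 (Complex.ext hre (neg_injective him))
  subst hqp
  have hmem : (⟨ε * q.re, δ * q.im⟩ : ℂ) - ⟨ε' * q.re, δ' * q.im⟩ ∈ Λ := by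
    refine mem_iff_re_im.mpr ⟨exists_int_sub hε hε' (hre'.imp_right fun h ↦ ?_),
      exists_int_sub hδ hδ' (him'.imp_right fun h ↦ ?_)⟩
    · by_contra! h'
      exact (periodicZeta_re_pos hq h'.1 h'.2).ne' h
    · by_contra! h'
      exact (periodicZeta_im_neg hq h'.1 h'.2).ne (neg_eq_zero.mp h)
  have := add_mem hqu (sub_mem hmem hpv)
  convert! this using 1
  ring

end Injective

/-! ### Independence of the differentials. -/

section Immersion

/-- For non-real ℘, a nonzero v would make (℘ + η)/℘' real and (℘ - η)/℘' purely imaginary; the sign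
of Re ℘ decides which one the cubic inequality excludes. For real ℘, only ℘ = ±η needs an argument,
and there 0 < η < e settles the sign of ℘'². -/
lemma eq_zero_of_forms_eq_zero {u v : ℂ} (hu : u ∉ Λ) (h1 : ((wp u + quasiPeriod) * v).re = 0)
    (h2 : ((wp u - quasiPeriod) * v).im = 0) (h3 : (wp' u * v).re = 0) : v = 0 := by
  obtain ⟨ha0, hae⟩ := quasiPeriod_mem
  by_cases him : (wp u).im = 0
  · have hsq := wp'_sq hu
    have hwp : wp u = ((wp u).re : ℂ) := Complex.ext (by simp) (by simpa using him)
    set x := (wp u).re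
    rw [hwp] at h1 h2 hsq
    rw [← ofReal_add, re_ofReal_mul] at h1
    rw [← ofReal_sub, im_ofReal_mul] at h2
    have hsq1 := congrArg re hsq
    have hsq2 := congrArg im hsq
    rw [← ofReal_pow, ← ofReal_pow, ← ofReal_sub, ← ofReal_mul, ← ofReal_ofNat, ← ofReal_mul]
      at hsq1 hsq2
    simp only [pow_two, mul_re, mul_im, ofReal_re, ofReal_im] at hsq1 hsq2
    rw [mul_re] at h3
    rcases mul_eq_zero.mp h1 with hx | hvr <;> rcases mul_eq_zero.mp h2 with hx' | hvi
    · linarith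
    · rw [hvi, mul_zero, sub_zero] at h3
      rcases mul_eq_zero.mp h3 with hw | hvr
      · exfalso
        have hx'' : x = -quasiPeriod := by linarith
        rw [hw, hx''] at hsq1
        -- At ℘ = -η, ℘'² = 4η(e² - η²) > 0, so ℘' cannot be purely imaginary.
        have : 0 < quasiPeriod * (wpHalf * wpHalf - quasiPeriod * quasiPeriod) :=
          mul_pos ha0 (by nlinarith)
        nlinarith [mul_self_nonneg (wp' u).im]
      · exact Complex.ext hvr hvi
    · rw [hvr, mul_zero, zero_sub, neg_eq_zero] at h3
      rcases mul_eq_zero.mp h3 with hw | hvi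
      · exfalso
        have hx'' : x = quasiPeriod := by linarith
        rw [hw, hx''] at hsq1
        -- At ℘ = η, ℘'² = -4η(e² - η²) < 0, so ℘' cannot be real.
        have : 0 < quasiPeriod * (wpHalf * wpHalf - quasiPeriod * quasiPeriod) :=
          mul_pos ha0 (by nlinarith)
        nlinarith [mul_self_nonneg (wp' u).re]
      · exact Complex.ext hvr hvi
    · exact Complex.ext hvr hvi
  · by_contra hv
    have hw : wp' u ≠ 0 := fun h ↦ by
      obtain ⟨-, n, hn⟩ := mem_iff_re_im.mp (two_mul_mem_of_wp'_eq_zero hu h)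
      exact him ((wp_im_eq_zero_iff hu).mpr (Or.inl ⟨n, by simpa using hn⟩))
    have hwv : wp' u * v ≠ 0 := mul_ne_zero hw hv
    have him3 : (wp' u * v).im ≠ 0 := fun h ↦ hwv (Complex.ext h3 h)
    rcases le_total 0 (wp u).re with h0 | h0
    · refine wp_add_ne_real_mul hu h0 him
        (((wp u + quasiPeriod) * v).im / (wp' u * v).im) (mul_right_cancel₀ hv ?_)
      rw [mul_assoc]
      refine Complex.ext ?_ ?_
      · rw [re_ofReal_mul, h1, h3, mul_zero]
      · rw [im_ofReal_mul, div_mul_cancel₀ _ him3]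
    · refine wp_sub_ne_imag_mul hu h0 him
        (-((wp u - quasiPeriod) * v).re / (wp' u * v).im) (mul_right_cancel₀ hv ?_)
      rw [mul_assoc, mul_assoc]
      refine Complex.ext ?_ ?_
      · rw [re_ofReal_mul, I_mul_re, neg_div, neg_mul_neg, div_mul_cancel₀ _ him3]
      · rw [im_ofReal_mul, I_mul_im, h2, h3, mul_zero]

end Immersion

/-! ### The square torus as a Riemann surface. -/

/-- The quotient of the complex plane by the Gaussian integers. -/
def SquareTorus : Type := UnitAddCircle × UnitAddCircle

namespace SquareTorus

instance : TopologicalSpace SquareTorus := inferInstanceAs (TopologicalSpace (_ × _))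
instance : T2Space SquareTorus := inferInstanceAs (T2Space (UnitAddCircle × UnitAddCircle))
instance : CompactSpace SquareTorus := inferInstanceAs (CompactSpace (UnitAddCircle × UnitAddCircle))
instance : ConnectedSpace SquareTorus :=
  inferInstanceAs (ConnectedSpace (UnitAddCircle × UnitAddCircle))

/-- The universal covering of the torus. -/
def proj (u : ℂ) : SquareTorus := ((u.re : UnitAddCircle), (u.im : UnitAddCircle))

lemma proj_eq_iff {u v : ℂ} : proj u = proj v ↔ u - v ∈ Λ := by
  have key : ∀ x y : ℝ, (x : UnitAddCircle) = y ↔ ∃ n : ℤ, x - y = n := by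
    intro x y
    rw [eq_comm, QuotientAddGroup.eq, AddSubgroup.mem_zmultiples_iff]
    simp only [zsmul_eq_mul, mul_one]
    exact exists_congr fun n ↦ ⟨fun h ↦ by linarith, fun h ↦ by linarith⟩
  rw [mem_iff_re_im, sub_re, sub_im, ← key, ← key]
  exact Prod.ext_iff

lemma proj_surjective : Function.Surjective proj := by
  rintro ⟨x, y⟩
  obtain ⟨a, rfl⟩ := QuotientAddGroup.mk_surjective x
  obtain ⟨b, rfl⟩ := QuotientAddGroup.mk_surjective y
  exact ⟨⟨a, b⟩, rfl⟩

lemma continuous_proj : Continuous proj :=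
  ((AddCircle.continuous_mk' 1).comp continuous_re).prodMk
    ((AddCircle.continuous_mk' 1).comp continuous_im)

/-- A section of the universal covering. -/
noncomputable def lift (x : SquareTorus) : ℂ := Function.surjInv proj_surjective x

@[simp] lemma proj_lift (x : SquareTorus) : proj (lift x) = x :=
  Function.surjInv_eq proj_surjective x

lemma lift_proj_sub_mem (u : ℂ) : lift (proj u) - u ∈ Λ := proj_eq_iff.mp (proj_lift _)

lemma lift_proj_eq {α : Type*} {F : ℂ → α} (hF : ∀ {l}, l ∈ Λ → ∀ u, F (u + l) = F u) (u : ℂ) :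
    F (lift (proj u)) = F u := eq_of_sub_mem hF (lift_proj_sub_mem u)

/-- The restriction of the universal covering to the open unit square centered at `c`. -/
noncomputable def localProj (c : ℂ) : OpenPartialHomeomorph ℂ SquareTorus :=
  equivRealProdCLM.toHomeomorph.toOpenPartialHomeomorph.trans
    ((AddCircle.openPartialHomeomorphCoe (1 : ℝ) (c.re - 1 / 2)).prod
      (AddCircle.openPartialHomeomorphCoe (1 : ℝ) (c.im - 1 / 2)))

@[simp] lemma localProj_apply (c u : ℂ) : localProj c u = proj u := rfl

lemma mem_localProj_source (c : ℂ) : c ∈ (localProj c).source := by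
  refine ⟨Set.mem_univ _, ⟨?_, ?_⟩, ⟨?_, ?_⟩⟩
  · change c.re - 1 / 2 < c.re
    linarith
  · change c.re < c.re - 1 / 2 + 1
    linarith
  · change c.im - 1 / 2 < c.im
    linarith
  · change c.im < c.im - 1 / 2 + 1
    linarith

noncomputable instance : ChartedSpace ℂ SquareTorus where
  atlas := Set.range fun c ↦ (localProj c).symm
  chartAt x := (localProj (lift x)).symm
  mem_chart_source x := by
    have := (localProj (lift x)).map_source (mem_localProj_source _)
    simpa using this
  chart_mem_atlas x := ⟨_, rfl⟩

lemma chartAt_eq (x : SquareTorus) : chartAt ℂ x = (localProj (lift x)).symm := rfl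

@[simp] lemma chartAt_symm_apply (x : SquareTorus) (u : ℂ) : (chartAt ℂ x).symm u = proj u := rfl

@[simp] lemma chartAt_self (x : SquareTorus) : chartAt ℂ x x = lift x := by
  have := (localProj (lift x)).left_inv (mem_localProj_source _)
  simpa [chartAt_eq] using this

lemma eq_zero_of_mem_of_norm_lt {l : ℂ} (hl : l ∈ Λ) (h : ‖l‖ < 1) : l = 0 := by
  obtain ⟨⟨m, hm⟩, ⟨n, hn⟩⟩ := mem_iff_re_im.mp hl
  have h1 := abs_lt.mp ((abs_re_le_norm l).trans_lt h)
  have h2 := abs_lt.mp ((abs_im_le_norm l).trans_lt h)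
  have hm0 := eq_zero_of_intCast_mem hm h1.1 h1.2
  have hn0 := eq_zero_of_intCast_mem hn h2.1 h2.2
  exact Complex.ext (by simp [hm, hm0]) (by simp [hn, hn0])

lemma proj_localProj_symm {c : ℂ} {x : SquareTorus} (hx : x ∈ (localProj c).target) :
    proj ((localProj c).symm x) = x := (localProj c).right_inv hx

/-- Two local inverses of the covering differ by a constant. -/
lemma eventually_localProj_symm_sub {c d : ℂ} {x : SquareTorus} (hc : x ∈ (localProj c).target)
    (hd : x ∈ (localProj d).target) : ∀ᶠ y in 𝓝 x, (localProj d).symm y - (localProj c).symm y =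
      (localProj d).symm x - (localProj c).symm x := by
  have hcont : ContinuousAt (fun y ↦ (localProj d).symm y - (localProj c).symm y) x :=
    ((localProj d).continuousAt_symm hd).sub ((localProj c).continuousAt_symm hc)
  filter_upwards [(localProj c).open_target.mem_nhds hc, (localProj d).open_target.mem_nhds hd,
    hcont.eventually_mem (Metric.ball_mem_nhds _ one_pos)] with y hyc hyd hy
  have hmem : ∀ {y}, y ∈ (localProj c).target → y ∈ (localProj d).target →
      (localProj d).symm y - (localProj c).symm y ∈ Λ := fun h1 h2 ↦
    proj_eq_iff.mp (by rw [proj_localProj_symm h1, proj_localProj_symm h2])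
  exact sub_eq_zero.mp (eq_zero_of_mem_of_norm_lt (sub_mem (hmem hyc hyd) (hmem hc hd))
    (by simpa [dist_eq_norm] using hy))

lemma eventually_localProj_symm_proj {c u : ℂ} (hc : proj u ∈ (localProj c).target) :
    ∀ᶠ v in 𝓝 u, (localProj c).symm (proj v) = v + ((localProj c).symm (proj u) - u) := by
  have hu := mem_localProj_source u
  have hu' : proj u ∈ (localProj u).target := (localProj u).map_source hu
  have h := continuous_proj.continuousAt.eventually (eventually_localProj_symm_sub hu' hc)
  filter_upwards [h, (localProj u).open_source.mem_nhds hu] with v hv hvs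
  have e1 : (localProj u).symm (proj v) = v := (localProj u).left_inv hvs
  have e2 : (localProj u).symm (proj u) = u := (localProj u).left_inv hu
  rw [e1, e2] at hv
  linear_combination hv

/-- Transition maps are locally translations. -/
instance isManifold : IsManifold 𝓘(ℂ) ω SquareTorus := by
  refine isManifold_of_contDiffOn _ _ _ ?_
  rintro _ _ ⟨c, rfl⟩ ⟨d, rfl⟩
  simp only [modelWithCornersSelf_coe, modelWithCornersSelf_coe_symm, Function.id_comp,
    Function.comp_id, Set.preimage_id, Set.range_id, Set.inter_univ]
  intro u hu
  have hu' : proj u ∈ (localProj d).target := by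
    simpa using hu.2
  refine ContDiffAt.contDiffWithinAt ?_
  refine ContDiffAt.congr_of_eventuallyEq (f := fun v ↦ v + ((localProj d).symm (proj u) - u))
    (by fun_prop) ?_
  exact eventually_localProj_symm_proj hu'

lemma isComplexTorus : IsComplexTorus SquareTorus where
  isManifold := inferInstance
  t2 := inferInstance
  compact := inferInstance
  connected := inferInstance
  torus := ⟨(AddCircle.homeomorphCircle one_ne_zero).prodCongr
    (AddCircle.homeomorphCircle one_ne_zero)⟩

/-! ### Regularity of functions on the torus, tested on the covering. -/

section Functions

variable {E : Type*} [NormedAddCommGroup E]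

lemma continuousAt_of_comp_proj {E : Type*} [TopologicalSpace E] {G : SquareTorus → E}
    {x : SquareTorus} (h : ContinuousAt (G ∘ proj) (lift x)) : ContinuousAt G x := by
  have hx : x ∈ (localProj (lift x)).target := mem_chart_source ℂ x
  have h1 : ContinuousAt ((G ∘ proj) ∘ (localProj (lift x)).symm) x := by
    refine ContinuousAt.comp ?_ ((localProj (lift x)).continuousAt_symm hx)
    have : (localProj (lift x)).symm x = lift x := chartAt_self x
    rwa [this]
  refine h1.congr ?_
  filter_upwards [(localProj (lift x)).open_target.mem_nhds hx] with y hy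
  simp [proj_localProj_symm hy]

lemma hasMFDerivAt_of_comp_proj [NormedSpace ℂ E] {G : SquareTorus → E} {x : SquareTorus}
    {G' : ℂ →L[ℂ] E} (h : HasFDerivAt (G ∘ proj) G' (lift x)) :
    HasMFDerivAt 𝓘(ℂ) 𝓘(ℂ, E) G x G' := by
  refine ⟨continuousAt_of_comp_proj h.continuousAt, ?_⟩
  simp only [writtenInExtChartAt, extChartAt, mfld_simps, chartAt_self]
  exact h.hasFDerivWithinAt

lemma hasMFDerivAt_real_of_comp_proj [NormedSpace ℝ E] {G : SquareTorus → E} {x : SquareTorus}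
    {G' : ℂ →L[ℝ] E} (h : HasFDerivAt (G ∘ proj) G' (lift x)) :
    HasMFDerivAt 𝓘(ℝ, ℂ) 𝓘(ℝ, E) G x G' := by
  refine ⟨continuousAt_of_comp_proj h.continuousAt, ?_⟩
  simp only [writtenInExtChartAt, extChartAt, mfld_simps, chartAt_self]
  exact h.hasFDerivWithinAt

lemma contMDiffAt_of_comp_proj [NormedSpace ℝ E] {G : SquareTorus → E} {x : SquareTorus}
    {n : WithTop ℕ∞} (h : ContDiffAt ℝ n (G ∘ proj) (lift x)) :
    ContMDiffAt 𝓘(ℝ, ℂ) 𝓘(ℝ, E) n G x := by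
  rw [contMDiffAt_iff]
  refine ⟨continuousAt_of_comp_proj h.continuousAt, ?_⟩
  simp only [extChartAt, mfld_simps, chartAt_self]
  exact h.contDiffWithinAt

lemma mfderiv_proj (u : ℂ) :
    mfderiv 𝓘(ℂ) 𝓘(ℂ) proj u = ContinuousLinearMap.id ℂ ℂ := by
  refine HasMFDerivAt.mfderiv ⟨continuous_proj.continuousAt, ?_⟩
  simp only [writtenInExtChartAt, extChartAt, mfld_simps]
  have h : HasFDerivAt (fun v ↦ (localProj (lift (proj u))).symm (proj v))
      (ContinuousLinearMap.id ℂ ℂ) u :=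
    ((hasFDerivAt_id u).add_const
      ((localProj (lift (proj u))).symm (proj u) - u)).congr_of_eventuallyEq
      (eventually_localProj_symm_proj (mem_chart_source ℂ (proj u)))
  exact h.hasFDerivWithinAt

end Functions

/-! ### Translation-invariant description of 1-forms. -/

section Forms

/-- The 1-form `h(u) du` on the torus. -/
noncomputable def form (h : ℂ → ℂ) : OneForm SquareTorus :=
  fun x ↦ (h (lift x) • ContinuousLinearMap.id ℂ ℂ : ℂ →L[ℂ] ℂ)

/-- The inverse chart is given by the covering on all of ℂ, with derivative 1, so the coefficient is
h everywhere and not only in the chart domain. -/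
lemma coeff_form {h : ℂ → ℂ} (hh : ∀ {l}, l ∈ Λ → ∀ u, h (u + l) = h u) (c : SquareTorus) :
    (form h).coeff c = h := by
  ext ζ
  change (h (lift (proj ζ)) • ContinuousLinearMap.id ℂ ℂ : ℂ →L[ℂ] ℂ)
    (mfderiv 𝓘(ℂ) 𝓘(ℂ) proj ζ (1 : ℂ)) = h ζ
  rw [mfderiv_proj, lift_proj_eq hh]
  exact mul_one (h ζ)

end Forms

/-! ### Path integrals on the torus. -/

section Paths

variable {γ : ℝ → SquareTorus} {a b : ℝ}

lemma hasDerivWithinAt_localProj_symm_comp (hγ : ContMDiffOn 𝓘(ℝ, ℝ) 𝓘(ℝ, ℂ) 1 γ (Set.Icc a b))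
    {t : ℝ} (ht : t ∈ Set.Icc a b) {c : ℂ} (hc : γ t ∈ (localProj c).target) :
    HasDerivWithinAt (fun s ↦ (localProj c).symm (γ s))
      (mfderivWithin 𝓘(ℝ, ℝ) 𝓘(ℝ, ℂ) γ (Set.Icc a b) t (1 : ℝ)) (Set.Icc a b) t := by
  have hd := ((hγ t ht).mdifferentiableWithinAt one_ne_zero).hasMFDerivWithinAt
  have h1 := hd.2
  simp only [writtenInExtChartAt, extChartAt, mfld_simps] at h1
  let D : ℝ →L[ℝ] ℂ := mfderivWithin 𝓘(ℝ, ℝ) 𝓘(ℝ, ℂ) γ (Set.Icc a b) t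
  have h2 : HasFDerivWithinAt (fun s ↦ (localProj (lift (γ t))).symm (γ s)) D (Set.Icc a b) t := h1
  change HasDerivWithinAt (fun s ↦ (localProj c).symm (γ s)) (D 1) (Set.Icc a b) t
  have h3 := h2.hasDerivWithinAt.add_const ((localProj c).symm (γ t) - (localProj (lift (γ t))).symm (γ t))
  refine h3.congr_of_eventuallyEq ?_ (by ring)
  filter_upwards [hd.1.eventually (eventually_localProj_symm_sub
    (mem_chart_source ℂ (γ t) : γ t ∈ (localProj (lift (γ t))).target) hc)] with s hs
  linear_combination hs

/-- The velocity is defined with a chart that changes with t. Local lifts differ by constants, so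
near each time it is the derivative of one fixed lift. -/
lemma continuousOn_velocity (hab : a < b) (hγ : ContMDiffOn 𝓘(ℝ, ℝ) 𝓘(ℝ, ℂ) 1 γ (Set.Icc a b)) :
    ContinuousOn (fun t ↦ (mfderivWithin 𝓘(ℝ, ℝ) 𝓘(ℝ, ℂ) γ (Set.Icc a b) t (1 : ℝ) : ℂ))
      (Set.Icc a b) := by
  intro t ht
  have hc : γ t ∈ (localProj (lift (γ t))).target := mem_chart_source ℂ (γ t)
  have h1 := (contMDiffWithinAt_iff.mp (hγ t ht)).2
  simp only [extChartAt, mfld_simps] at h1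
  have h2 : ContDiffWithinAt ℝ 1 (fun s ↦ (localProj (lift (γ t))).symm (γ s)) (Set.Icc a b) t := h1
  have h3 := (h2.fderivWithin_right (m := 0) (uniqueDiffOn_Icc hab) (by simp)
    ht).continuousWithinAt.clm_apply (continuousWithinAt_const (b := (1 : ℝ)))
  have hev : ∀ᶠ s in 𝓝[Set.Icc a b] t, γ s ∈ (localProj (lift (γ t))).target :=
    (hγ t ht).continuousWithinAt.eventually_mem ((localProj _).open_target.mem_nhds hc)
  refine h3.congr_of_eventuallyEq_of_mem ?_ ht
  filter_upwards [hev, self_mem_nhdsWithin] with s hs hs'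
  exact ((hasDerivWithinAt_localProj_symm_comp hγ hs' hs).derivWithin
    (uniqueDiffOn_Icc hab s hs')).symm

/-- The fundamental theorem of calculus for a function whose differential is `Re (h(u) du)`. -/
lemma sub_eq_re_pathIntegral {S : Set SquareTorus} {h : ℂ → ℂ} {G : SquareTorus → ℝ}
    (hh : ∀ {l}, l ∈ Λ → ∀ u, h (u + l) = h u)
    (hc : ∀ u, proj u ∉ S → ContinuousAt h u)
    (hG : ∀ u, proj u ∉ S → HasFDerivAt (G ∘ proj)
      (reCLM.comp ((h u • ContinuousLinearMap.id ℂ ℂ : ℂ →L[ℂ] ℂ).restrictScalars ℝ)) u)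
    (hab : a < b) (hγ : ContMDiffOn 𝓘(ℝ, ℝ) 𝓘(ℝ, ℂ) 1 γ (Set.Icc a b))
    (hS : ∀ t ∈ Set.Icc a b, γ t ∉ S) :
    G (γ b) - G (γ a) = (pathIntegral (form h) γ a b).re := by
  set V : ℝ → ℂ := fun t ↦ mfderivWithin 𝓘(ℝ, ℝ) 𝓘(ℝ, ℂ) γ (Set.Icc a b) t (1 : ℝ)
  have hV := continuousOn_velocity hab hγ
  have hform : ∀ t, form h (γ t) (V t) = h (lift (γ t)) * V t := fun t ↦ rfl
  have hcont : ContinuousOn (fun t ↦ form h (γ t) (V t)) (Set.Icc a b) := by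
    simp only [hform]
    refine ContinuousOn.mul (fun t ht ↦ ?_) hV
    have : ContinuousAt (fun x ↦ h (lift x)) (γ t) := by
      refine continuousAt_of_comp_proj ?_
      have e : (fun x ↦ h (lift x)) ∘ proj = h := funext fun u ↦ lift_proj_eq hh u
      rw [e]
      exact hc _ (by simpa using hS t ht)
    exact this.comp_continuousWithinAt (hγ t ht).continuousWithinAt
  have hderiv : ∀ t ∈ Set.Icc a b,
      HasDerivWithinAt (fun t ↦ G (γ t)) (form h (γ t) (V t)).re (Set.Icc a b) t := by
    intro t ht
    have hx : γ t ∈ (localProj (lift (γ t))).target := mem_chart_source ℂ (γ t)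
    have hl : (localProj (lift (γ t))).symm (γ t) = lift (γ t) := chartAt_self (γ t)
    have h1 := hasDerivWithinAt_localProj_symm_comp hγ ht hx
    have h2 := HasFDerivAt.comp_hasDerivWithinAt (f := fun s ↦ (localProj (lift (γ t))).symm (γ s)) t
      (hG ((localProj (lift (γ t))).symm (γ t)) (by rw [hl]; simpa using hS t ht)) h1
    rw [hl] at h2
    refine h2.congr_of_eventuallyEq ?_ ?_
    · filter_upwards [(hγ t ht).continuousWithinAt.eventually_mem
        ((localProj (lift (γ t))).open_target.mem_nhds hx)] with s hs
      simp [proj_localProj_symm hs]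
    · simp [proj_localProj_symm hx]
  have hint : IntervalIntegrable (fun t ↦ form h (γ t) (V t)) MeasureTheory.volume a b :=
    ContinuousOn.intervalIntegrable_of_Icc hab.le hcont
  have hre : IntervalIntegrable (fun t ↦ (form h (γ t) (V t)).re) MeasureTheory.volume a b :=
    ContinuousOn.intervalIntegrable_of_Icc hab.le
      (continuous_re.comp_continuousOn hcont)
  rw [← intervalIntegral.integral_eq_sub_of_hasDerivAt_of_le hab.le
    (fun t ht ↦ (hderiv t ht).continuousWithinAt)
    (fun t ht ↦ (hderiv t (Set.Ioo_subset_Icc_self ht)).hasDerivAt (Icc_mem_nhds ht.1 ht.2)) hre]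
  exact (reCLM.intervalIntegral_comp_comm hint)

end Paths

end SquareTorus

namespace SquareTorus

/-- The puncture of the torus. -/
def puncture : SquareTorus := proj 0

lemma proj_eq_puncture_iff {u : ℂ} : proj u = puncture ↔ u ∈ Λ := by
  rw [puncture, proj_eq_iff, sub_zero]

lemma lift_notMem_iff {x : SquareTorus} : lift x ∉ Λ ↔ x ≠ puncture := by
  rw [Ne, ← proj_eq_puncture_iff, proj_lift]

/-! ### Identification of the punctured torus with the affine curve. -/

section Curve

/-- The coordinate `z` of the affine curve. -/
noncomputable def curveZ (x : SquareTorus) : ℂ := wp (lift x) / wpHalf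

/-- The coordinate `w` of the affine curve. -/
noncomputable def curveW (x : SquareTorus) : ℂ :=
  wp' (lift x) / (2 * wpHalf * (√wpHalf : ℝ))

lemma curveZ_comp_proj : curveZ ∘ proj = fun u ↦ wp u / wpHalf := by
  ext u
  simp [curveZ, lift_proj_eq wp_add]

lemma curveW_comp_proj : curveW ∘ proj = fun u ↦ wp' u / (2 * wpHalf * (√wpHalf : ℝ)) := by
  ext u
  simp [curveW, lift_proj_eq wp'_add]

lemma ofReal_wpHalf_ne_zero : (wpHalf : ℂ) ≠ 0 := ofReal_ne_zero.mpr wpHalf_pos.ne'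

lemma ofReal_sqrt_ne_zero : ((√wpHalf : ℝ) : ℂ) ≠ 0 :=
  ofReal_ne_zero.mpr (Real.sqrt_pos.mpr wpHalf_pos).ne'

lemma ofReal_sqrt_sq : ((√wpHalf : ℝ) : ℂ) ^ 2 = wpHalf := by
  rw [← ofReal_pow, Real.sq_sqrt wpHalf_pos.le]

lemma hasMFDerivAt_curveZ {x : SquareTorus} (hx : x ≠ puncture) :
    HasMFDerivAt 𝓘(ℂ) 𝓘(ℂ) curveZ x
      ((wp' (lift x) / wpHalf) • ContinuousLinearMap.id ℂ ℂ : ℂ →L[ℂ] ℂ) := by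
  refine hasMFDerivAt_of_comp_proj ?_
  rw [curveZ_comp_proj]
  have h := ((hasDerivAt_wp (lift_notMem_iff.mpr hx)).div_const (wpHalf : ℂ)).hasFDerivAt
  convert! h using 1
  ext
  simp

/-- Injectivity is the separation of points by (℘, ℘'). For surjectivity, ℘ attains the prescribed
z, and the sign of w is adjusted by u ↦ -u. -/
lemma isAffineCurveModel : IsAffineCurveModel puncture curveZ curveW where
  holomorphic_z x hx := (hasMFDerivAt_curveZ hx).mdifferentiableAt
  holomorphic_w x hx := by
    have h : DifferentiableAt ℂ (curveW ∘ proj) (lift x) := by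
      rw [curveW_comp_proj]
      exact ((hasDerivAt_wp' (lift_notMem_iff.mpr hx)).div_const _).differentiableAt
    exact (hasMFDerivAt_of_comp_proj h.hasFDerivAt).mdifferentiableAt
  bijOn := by
    have he := ofReal_wpHalf_ne_zero
    have hs := ofReal_sqrt_ne_zero
    have hs2 := ofReal_sqrt_sq
    have hsq : ∀ w z : ℂ, w ^ 2 = 4 * (z * (z ^ 2 - (wpHalf : ℂ) ^ 2)) ↔
        (w / (2 * wpHalf * (√wpHalf : ℝ))) ^ 2 =
          z / wpHalf * (z / wpHalf - 1) * (z / wpHalf + 1) := by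
      intro w z
      have e1 : (w / (2 * wpHalf * (√wpHalf : ℝ))) ^ 2 = w ^ 2 / (4 * wpHalf ^ 3) := by
        rw [div_pow, mul_pow, mul_pow, hs2]
        ring
      have e2 : z / wpHalf * (z / wpHalf - 1) * (z / wpHalf + 1) =
          4 * (z * (z ^ 2 - (wpHalf : ℂ) ^ 2)) / (4 * wpHalf ^ 3) := by
        field_simp
        ring
      rw [e1, e2, div_left_inj' (by simpa using he)]
    refine ⟨fun x hx ↦ ?_, fun x hx y hy h ↦ ?_, ?_⟩
    · exact (hsq _ _).mp (wp'_sq (lift_notMem_iff.mpr hx))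
    · have h1 : wp (lift x) = wp (lift y) := (div_left_inj' he).mp (congrArg Prod.fst h)
      have h2 : wp' (lift x) = wp' (lift y) :=
        (div_left_inj' (mul_ne_zero (mul_ne_zero two_ne_zero he) hs)).mp
          (congrArg Prod.snd h)
      have h3 := sub_mem_of_wp_eq_of_wp'_eq (lift_notMem_iff.mpr hx) (lift_notMem_iff.mpr hy) h1 h2
      have h4 := proj_eq_iff.mpr h3
      simpa using h4.symm
    · rintro ⟨z, w⟩ hq
      have hq : w ^ 2 = z * (z - 1) * (z + 1) := hq
      obtain ⟨u, hu, hz⟩ := wp_surjective (wpHalf * z)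
      have hz' : wp u / wpHalf = z := by rw [hz, mul_div_cancel_left₀ _ he]
      have h1 := (hsq _ _).mp (wp'_sq hu)
      rw [hz', ← hq] at h1
      rcases sq_eq_sq_iff_eq_or_eq_neg.mp h1 with h | h
      · refine ⟨proj u, fun h ↦ hu (proj_eq_puncture_iff.mp h), ?_⟩
        exact Prod.ext ((congrFun curveZ_comp_proj u).trans hz')
          ((congrFun curveW_comp_proj u).trans h)
      · refine ⟨proj (-u), fun h ↦ hu (neg_mem_iff.mp (proj_eq_puncture_iff.mp h)), ?_⟩
        refine Prod.ext ((congrFun curveZ_comp_proj (-u)).trans ?_)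
          ((congrFun curveW_comp_proj (-u)).trans ?_)
        · rw [wp_neg, hz']
        · rw [wp'_neg, neg_div, h, neg_neg]

end Curve

/-! ### The coordinate forms and the harmonic map. -/

section Surface

/-- The normalizing factor relating `dz / w` to `du`. -/
noncomputable def scale : ℝ := 2 / √wpHalf

lemma scale_pos : 0 < scale := div_pos two_pos (Real.sqrt_pos.mpr wpHalf_pos)

lemma ofReal_scale : (scale : ℂ) = 2 / (√wpHalf : ℝ) := by simp [scale]

/-- The coefficients of the coordinate forms with respect to `du`. -/
noncomputable def formCoeff : Fin 3 → ℂ → ℂ :=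
  ![fun u ↦ scale * (wp u + quasiPeriod), fun u ↦ I * (scale * (wp u - quasiPeriod)),
    fun u ↦ wp' u / wpHalf]

/-- The primitives of the coordinate forms on the universal covering. -/
noncomputable def primitive : Fin 3 → ℂ → ℂ :=
  ![fun u ↦ -(scale * (wzeta u - quasiPeriod * u)), fun u ↦ -(I * (scale * (wzeta u + quasiPeriod * u))),
    fun u ↦ wp u / wpHalf]

/-- The harmonic torus. -/
noncomputable def harmonicTorus (x : SquareTorus) : E3 :=
  !₂[-(scale * (periodicZeta (lift x)).re), scale * (periodicZeta (lift x)).im,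
    (wp (lift x)).re / wpHalf]

lemma formCoeff_add {l : ℂ} (hl : l ∈ Λ) (i : Fin 3) (u : ℂ) :
    formCoeff i (u + l) = formCoeff i u := by
  fin_cases i <;> simp [formCoeff, wp_add hl, wp'_add hl]

lemma harmonicTorus_proj (u : ℂ) : harmonicTorus (proj u) =
    !₂[-(scale * (periodicZeta u).re), scale * (periodicZeta u).im, (wp u).re / wpHalf] := by
  rw [harmonicTorus, lift_proj_eq wp_add, lift_proj_eq periodicZeta_add]

lemma hasDerivAt_primitive {u : ℂ} (hu : u ∉ Λ) (i : Fin 3) :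
    HasDerivAt (primitive i) (formCoeff i u) u := by
  fin_cases i
  · convert! ((hasDerivAt_wzeta_sub hu).const_mul (scale : ℂ)).neg using 1
    simp [formCoeff]
    ring
  · convert! (((hasDerivAt_wzeta_add hu).const_mul (scale : ℂ)).const_mul I).neg using 1
    simp [formCoeff]
    ring
  · exact (hasDerivAt_wp hu).div_const _

lemma harmonicTorus_proj_apply {u : ℂ} (hu : u ∉ Λ) (i : Fin 3) :
    harmonicTorus (proj u) i = (primitive i u).re := by
  rw [harmonicTorus_proj]
  fin_cases i
  · simp [primitive, periodicZeta_re hu]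
  · simp [primitive, periodicZeta_im hu]
  · simp [primitive]

lemma analyticAt_formCoeff {u : ℂ} (hu : u ∉ Λ) (i : Fin 3) : AnalyticAt ℂ (formCoeff i) u := by
  have h1 := analyticOnNhd_wp u hu
  have h2 := analyticOnNhd_wp' u hu
  fin_cases i
  · exact analyticAt_const.mul (h1.add analyticAt_const)
  · exact analyticAt_const.mul (analyticAt_const.mul (h1.sub analyticAt_const))
  · exact h2.div analyticAt_const ofReal_wpHalf_ne_zero

lemma analyticAt_primitive {u : ℂ} (hu : u ∉ Λ) (i : Fin 3) : AnalyticAt ℂ (primitive i) u := by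
  refine DifferentiableOn.analyticAt (s := (Λ : Set ℂ)ᶜ) (fun v hv ↦
    (hasDerivAt_primitive hv i).differentiableAt.differentiableWithinAt) ?_
  exact isOpen_compl.mem_nhds hu

lemma eventually_harmonicTorus_proj {u : ℂ} (hu : u ∉ Λ) (i : Fin 3) :
    (fun v ↦ harmonicTorus (proj v) i) =ᶠ[𝓝 u] fun v ↦ (primitive i v).re := by
  filter_upwards [isOpen_compl.mem_nhds hu] with v hv
  exact harmonicTorus_proj_apply hv i

lemma hasFDerivAt_harmonicTorus_proj {u : ℂ} (hu : u ∉ Λ) (i : Fin 3) :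
    HasFDerivAt (fun v ↦ harmonicTorus (proj v) i)
      (reCLM.comp ((formCoeff i u • ContinuousLinearMap.id ℂ ℂ : ℂ →L[ℂ] ℂ).restrictScalars ℝ)) u := by
  have h := reCLM.hasFDerivAt.comp u
    ((hasDerivAt_primitive hu i).hasFDerivAt.restrictScalars ℝ)
  refine HasFDerivAt.congr_of_eventuallyEq ?_ (eventually_harmonicTorus_proj hu i)
  convert! h using 1
  ext v
  simp [mul_comm]

lemma meromorphicAt_formCoeff (u : ℂ) (i : Fin 3) : MeromorphicAt (formCoeff i) u := by
  have h1 : MeromorphicAt wp u := gaussianPeriods.meromorphic_weierstrassP u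
  have h2 : MeromorphicAt wp' u := gaussianPeriods.meromorphic_derivWeierstrassP u
  have hc : ∀ c : ℂ, MeromorphicAt (fun _ ↦ c) u := fun c ↦ MeromorphicAt.const c u
  fin_cases i
  · exact (hc _).mul (h1.add (hc _))
  · exact (hc _).mul ((hc _).mul (h1.sub (hc _)))
  · exact h2.div (hc _)

/-- The coordinate forms of the harmonic torus. -/
noncomputable def forms (i : Fin 3) : OneForm SquareTorus := form (formCoeff i)

lemma coeff_forms (i : Fin 3) (c : SquareTorus) : (forms i).coeff c = formCoeff i :=
  coeff_form (fun hl u ↦ formCoeff_add hl i u) c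

lemma isHolomorphicAt_forms (i : Fin 3) {x : SquareTorus} (hx : x ≠ puncture) :
    (forms i).IsHolomorphicAt x := by
  rw [OneForm.IsHolomorphicAt, coeff_forms, chartAt_self]
  exact analyticAt_formCoeff (lift_notMem_iff.mpr hx) i

lemma differential_curveZ {x : SquareTorus} (hx : x ≠ puncture) :
    differential curveZ x = ((wp' (lift x) / wpHalf) • ContinuousLinearMap.id ℂ ℂ : ℂ →L[ℂ] ℂ) :=
  (hasMFDerivAt_curveZ hx).mfderiv

/-- Since dz/w = 2√e du, dividing ℘ ± η by e leaves the factor 2/√e, which is `scale`. -/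
lemma hasTorusForms : HasTorusForms puncture curveZ curveW (quasiPeriod / wpHalf)
    (-(quasiPeriod / wpHalf)) forms where
  holomorphic i x hx := isHolomorphicAt_forms i hx
  first x hx := by
    rw [differential_curveZ hx]
    change (curveW x • (formCoeff 0 (lift x) • ContinuousLinearMap.id ℂ ℂ) : ℂ →L[ℂ] ℂ) =
      (curveZ x + (quasiPeriod / wpHalf : ℝ)) •
        ((wp' (lift x) / wpHalf) • ContinuousLinearMap.id ℂ ℂ)
    rw [smul_smul, smul_smul]
    congr 1
    have he := ofReal_wpHalf_ne_zero
    have hs := ofReal_sqrt_ne_zero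
    have hs2 := ofReal_sqrt_sq
    simp only [curveW, formCoeff, Matrix.cons_val_zero, ofReal_scale, curveZ, ofReal_div]
    field_simp
    rw [hs2]
  second x hx := by
    rw [differential_curveZ hx]
    change (curveW x • (formCoeff 1 (lift x) • ContinuousLinearMap.id ℂ ℂ) : ℂ →L[ℂ] ℂ) =
      (I * (curveZ x + (-(quasiPeriod / wpHalf) : ℝ))) •
        ((wp' (lift x) / wpHalf) • ContinuousLinearMap.id ℂ ℂ)
    rw [smul_smul, smul_smul]
    congr 1
    have he := ofReal_wpHalf_ne_zero
    have hs := ofReal_sqrt_ne_zero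
    have hs2 := ofReal_sqrt_sq
    simp only [curveW, formCoeff, Matrix.cons_val_one, Matrix.cons_val_zero, ofReal_scale, curveZ,
      ofReal_div, ofReal_neg]
    field_simp
    rw [hs2]
    ring
  third x hx := (differential_curveZ hx).symm

lemma isHarmonicSurface : IsHarmonicSurface {puncture} forms harmonicTorus where
  isCompactRiemannSurface := isComplexTorus.toIsCompactRiemannSurface
  meromorphic i p _ := by
    rw [OneForm.IsMeromorphicAt, coeff_forms]
    exact meromorphicAt_formCoeff _ i
  holomorphic i x hx := isHolomorphicAt_forms i (by simpa using hx)
  eq_integral a b γ hab hγ hS i := by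
    have hmem : ∀ {u}, proj u ∉ ({puncture} : Set SquareTorus) → u ∉ Λ := fun hu h ↦
      hu (proj_eq_puncture_iff.mpr h)
    exact sub_eq_re_pathIntegral (S := {puncture}) (G := fun x ↦ harmonicTorus x i)
      (fun hl u ↦ formCoeff_add hl i u)
      (fun u hu ↦ (analyticAt_formCoeff (hmem hu) i).continuousAt)
      (fun u hu ↦ hasFDerivAt_harmonicTorus_proj (hmem hu) i) hab hγ
      (fun t ht ↦ by simpa using hS t ht)

lemma isHarmonicOff : IsHarmonicOff {puncture} harmonicTorus := by
  intro x hx i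
  have hx' : lift x ∉ Λ := lift_notMem_iff.mpr (by simpa using hx)
  rw [chartAt_self]
  refine (InnerProductSpace.harmonicAt_congr_nhds (eventually_harmonicTorus_proj hx' i)).mpr ?_
  exact (analyticAt_primitive hx' i).harmonicAt_re

end Surface

/-! ### Immersion, properness, embedding and completeness. -/

section Embedding

lemma contDiffAt_harmonicTorus_proj {u : ℂ} (hu : u ∉ Λ) {n : WithTop ℕ∞} :
    ContDiffAt ℝ n (harmonicTorus ∘ proj) u := by
  rw [contDiffAt_euclidean]
  intro i
  have h := reCLM.contDiff.contDiffAt.comp u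
    ((analyticAt_primitive hu i).contDiffAt.restrict_scalars ℝ (n := n))
  exact h.congr_of_eventuallyEq (eventually_harmonicTorus_proj hu i)

lemma isImmersionOff : IsImmersionOff {puncture} harmonicTorus := by
  intro x hx
  have hx' : lift x ∉ Λ := lift_notMem_iff.mpr (by simpa using hx)
  refine ⟨contMDiffAt_of_comp_proj (contDiffAt_harmonicTorus_proj hx'), ?_⟩
  have hd := ((contDiffAt_harmonicTorus_proj hx' (n := 1)).differentiableAt one_ne_zero).hasFDerivAt
  rw [(hasMFDerivAt_real_of_comp_proj hd).mfderiv]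
  set D : ℂ →L[ℝ] E3 := fderiv ℝ (harmonicTorus ∘ proj) (lift x)
  change Function.Injective D
  rw [injective_iff_map_eq_zero]
  intro v hv
  have key : ∀ i, (formCoeff i (lift x) * v).re = 0 := by
    intro i
    have h1 := (EuclideanSpace.proj (𝕜 := ℝ) i).hasFDerivAt.comp (lift x) hd
    have h2 := h1.unique (hasFDerivAt_harmonicTorus_proj hx' i)
    have h3 := congrArg (fun L : ℂ →L[ℝ] ℝ ↦ L v) h2
    simp only [ContinuousLinearMap.comp_apply] at h3
    change _ = (formCoeff i (lift x) * v).re at h3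
    rw [← h3]
    change (D v) i = 0
    rw [hv]
    rfl
  have k0 := key 0
  have k1 := key 1
  have k2 := key 2
  simp only [formCoeff, Matrix.cons_val_zero, Matrix.cons_val_one, Matrix.cons_val] at k0 k1 k2
  rw [mul_assoc, re_ofReal_mul] at k0
  rw [mul_assoc, mul_assoc, I_mul_re, im_ofReal_mul, neg_eq_zero] at k1
  rw [div_mul_eq_mul_div, div_ofReal_re] at k2
  exact eq_zero_of_forms_eq_zero hx' ((mul_eq_zero.mp k0).resolve_left scale_pos.ne')
    ((mul_eq_zero.mp k1).resolve_left scale_pos.ne')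
    ((div_eq_zero_iff.mp k2).resolve_right wpHalf_pos.ne')

lemma continuousAt_harmonicTorus {x : SquareTorus} (hx : x ≠ puncture) :
    ContinuousAt harmonicTorus x :=
  continuousAt_of_comp_proj
    (contDiffAt_harmonicTorus_proj (lift_notMem_iff.mpr hx) (n := 0)).continuousAt

lemma harmonicTorus_injOn : Set.InjOn harmonicTorus {puncture}ᶜ := by
  intro x hx y hy h
  have h0 := congrArg (fun q : E3 ↦ q 0) h
  have h1 := congrArg (fun q : E3 ↦ q 1) h
  have h2 := congrArg (fun q : E3 ↦ q 2) h
  simp only [harmonicTorus, PiLp.toLp_apply, Matrix.cons_val_zero, Matrix.cons_val_one,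
    Matrix.cons_val] at h0 h1 h2
  have h3 := sub_mem_of_periodicZeta_eq (lift_notMem_iff.mpr hx) (lift_notMem_iff.mpr hy)
    ((div_left_inj' wpHalf_pos.ne').mp h2)
    (Complex.ext (mul_left_cancel₀ scale_pos.ne' (neg_injective h0))
      (mul_left_cancel₀ scale_pos.ne' h1))
  simpa using proj_eq_iff.mpr h3

/-- Z is 1/u plus a function continuous at 0. -/
lemma tendsto_norm_periodicZeta :
    Filter.Tendsto (fun u ↦ ‖periodicZeta u‖) (𝓝[≠] 0) Filter.atTop := by
  have hc : ContinuousAt (fun u ↦ gaussianPeriods.weierstrassZetaExcept u - quasiPeriod * conj u)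
      0 := (gaussianPeriods.hasDerivAt_weierstrassZetaExcept (z := 0) (by simp)).continuousAt.sub
      (by fun_prop)
  have h1 : Filter.Tendsto (fun u : ℂ ↦ ‖u⁻¹‖) (𝓝[≠] 0) Filter.atTop :=
    tendsto_norm_cobounded_atTop.comp Filter.tendsto_inv₀_nhdsNE_zero
  have h2 : Filter.Tendsto
      (fun u ↦ -‖gaussianPeriods.weierstrassZetaExcept u - quasiPeriod * conj u‖) (𝓝[≠] 0)
      (𝓝 _) := (hc.norm.neg.tendsto).mono_left nhdsWithin_le_nhds
  refine Filter.tendsto_atTop_mono' _ ?_ (h1.atTop_add h2)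
  filter_upwards [eventually_notMem_lattice] with u hu
  rw [periodicZeta_of_notMem hu, wzeta, add_sub_assoc, ← sub_eq_add_neg]
  exact norm_sub_le_norm_add _ _

lemma norm_harmonicTorus_ge (u : ℂ) : scale * ‖periodicZeta u‖ ≤ ‖harmonicTorus (proj u)‖ := by
  refine le_of_sq_le_sq ?_ (norm_nonneg _)
  rw [EuclideanSpace.norm_sq_eq, harmonicTorus_proj, Fin.sum_univ_three, mul_pow,
    ← normSq_eq_norm_sq, normSq_apply]
  simp only [Matrix.cons_val_zero, Matrix.cons_val_one, Matrix.cons_val,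
    Real.norm_eq_abs, sq_abs]
  nlinarith [sq_nonneg ((wp u).re / wpHalf)]

lemma tendsto_norm_harmonicTorus :
    Filter.Tendsto (fun x ↦ ‖harmonicTorus x‖) (𝓝[≠] puncture) Filter.atTop := by
  have hp : puncture ∈ (localProj 0).target := (localProj 0).map_source (mem_localProj_source 0)
  have h0 : (localProj 0).symm puncture = 0 := (localProj 0).left_inv (mem_localProj_source 0)
  have ht : Filter.Tendsto (localProj 0).symm (𝓝[≠] puncture) (𝓝[≠] 0) := by
    refine tendsto_nhdsWithin_iff.mpr ⟨?_, ?_⟩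
    · have := ((localProj 0).continuousAt_symm hp).tendsto
      rw [h0] at this
      exact this.mono_left nhdsWithin_le_nhds
    · filter_upwards [nhdsWithin_le_nhds ((localProj 0).open_target.mem_nhds hp),
        self_mem_nhdsWithin] with x hx hxp h
      have h : (localProj 0).symm x = 0 := h
      exact hxp (by rw [← proj_localProj_symm hx, h]; rfl)
  refine Filter.tendsto_atTop_mono' _ ?_
    ((tendsto_norm_periodicZeta.const_mul_atTop scale_pos).comp ht)
  filter_upwards [nhdsWithin_le_nhds ((localProj 0).open_target.mem_nhds hp)] with x hx
  have := norm_harmonicTorus_ge ((localProj 0).symm x)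
  rwa [proj_localProj_symm hx] at this

/-- Outside a neighborhood of the puncture lie all points with image in a given ball. -/
lemma exists_isOpen_norm_gt (R : ℝ) : ∃ U : Set SquareTorus, IsOpen U ∧ puncture ∈ U ∧
    ∀ x ∈ U, x ≠ puncture → R < ‖harmonicTorus x‖ := by
  have h := tendsto_norm_harmonicTorus.eventually_gt_atTop R
  rw [eventually_nhdsWithin_iff, eventually_nhds_iff] at h
  obtain ⟨U, hU, hUo, hp⟩ := h
  exact ⟨U, hUo, hp, hU⟩

lemma isProperMap_harmonicTorus :
    IsProperMap (fun x : {x : SquareTorus // x ∉ ({puncture} : Finset SquareTorus)} ↦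
      harmonicTorus x) := by
  rw [isProperMap_iff_isCompact_preimage]
  refine ⟨continuous_iff_continuousAt.mpr fun x ↦ ?_, fun K hK ↦ ?_⟩
  · exact ContinuousAt.comp (g := harmonicTorus)
      (continuousAt_harmonicTorus (by simpa using x.2)) continuousAt_subtype_val
  · obtain ⟨R, hR⟩ := hK.isBounded.exists_norm_le
    obtain ⟨U, hUo, hpU, hU⟩ := exists_isOpen_norm_gt R
    have hne : ∀ x ∈ Uᶜ, x ≠ puncture := fun x hx h ↦ hx (h ▸ hpU)
    have hclosed : IsClosed (Uᶜ ∩ harmonicTorus ⁻¹' K) :=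
      ContinuousOn.preimage_isClosed_of_isClosed
        (fun x hx ↦ (continuousAt_harmonicTorus (hne x hx)).continuousWithinAt)
        hUo.isClosed_compl hK.isClosed
    rw [Subtype.isCompact_iff]
    convert! hclosed.isCompact using 1
    ext x
    constructor
    · rintro ⟨y, hy, rfl⟩
      exact ⟨fun hyU ↦ (hR _ hy).not_gt (hU _ hyU (by simpa using y.2)), hy⟩
    · rintro ⟨hx, hxK⟩
      exact ⟨⟨x, by simpa using hne x hx⟩, hxK, rfl⟩

lemma isProperEmbeddingOff : IsProperEmbeddingOff {puncture} harmonicTorus where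
  immersion := isImmersionOff
  embedding := by
    refine (Topology.IsClosedEmbedding.of_continuous_injective_isClosedMap
      isProperMap_harmonicTorus.continuous ?_ isProperMap_harmonicTorus.isClosedMap).isEmbedding
    intro x y h
    exact Subtype.ext (harmonicTorus_injOn (by simpa using x.2) (by simpa using y.2) h)
  proper := isProperMap_harmonicTorus

/-- A divergent path enters every neighbourhood of the puncture, where f is unbounded, while a path
of finite length keeps its image in a ball. -/
lemma isCompleteOff : IsCompleteOff {puncture} harmonicTorus := by
  intro γ _ hγp hdiv
  by_contra hV
  set V := eVariationOn (harmonicTorus ∘ γ) (Set.Ici 0)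
  -- The radius exceeds every norm that the image could reach from its starting point with length V.
  obtain ⟨U, hUo, hpU, hU⟩ := exists_isOpen_norm_gt (‖harmonicTorus (γ 0)‖ + V.toReal)
  have h1 := hdiv Uᶜ hUo.isClosed_compl.isCompact fun x hx h ↦
    hx ((Finset.mem_singleton.mp h) ▸ hpU)
  obtain ⟨t, ht, ht0⟩ := (h1.and (Filter.eventually_ge_atTop 0)).exists
  have h2 := hU (γ t) (by simpa using ht) (by simpa using hγp t ht0)
  have h3 : edist (harmonicTorus (γ t)) (harmonicTorus (γ 0)) ≤ V :=
    eVariationOn.edist_le (harmonicTorus ∘ γ) (show t ∈ Set.Ici (0 : ℝ) from ht0)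
      Set.self_mem_Ici
  have h4 : dist (harmonicTorus (γ t)) (harmonicTorus (γ 0)) ≤ V.toReal := by
    rw [dist_edist]
    exact ENNReal.toReal_mono hV h3
  rw [dist_eq_norm] at h4
  have := norm_sub_norm_le (harmonicTorus (γ t)) (harmonicTorus (γ 0))
  linarith

end Embedding

/-! ### Pole orders and the type of the end. -/

section EndType

lemma meromorphicOrderAt_wp {u : ℂ} (hu : u ∈ Λ) : meromorphicOrderAt wp u = ((-2 : ℤ) : WithTop ℤ) :=
  gaussianPeriods.order_weierstrassP u hu

lemma meromorphicOrderAt_wp' {u : ℂ} (hu : u ∈ Λ) :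
    meromorphicOrderAt wp' u = ((-3 : ℤ) : WithTop ℤ) := by
  have h := meromorphicOrderAt_deriv_eq_sub_one (by norm_num) (meromorphicOrderAt_wp hu)
  rw [show wp' = deriv wp from gaussianPeriods.deriv_weierstrassP.symm, h]
  norm_num

lemma meromorphicOrderAt_mul_wp_add {u : ℂ} (hu : u ∈ Λ) {c : ℂ} (hc : c ≠ 0) (d : ℂ) :
    meromorphicOrderAt ((fun _ ↦ c) * wp + fun _ ↦ d) u = ((-2 : ℤ) : WithTop ℤ) := by
  have h1 : meromorphicOrderAt ((fun _ ↦ c) * wp) u = ((-2 : ℤ) : WithTop ℤ) := by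
    rw [meromorphicOrderAt_mul_of_ne_zero analyticAt_const hc, meromorphicOrderAt_wp hu]
  rw [meromorphicOrderAt_add_eq_left_of_lt (MeromorphicAt.const d u), h1]
  rw [h1]
  refine lt_of_lt_of_le ?_ (AnalyticAt.meromorphicOrderAt_nonneg analyticAt_const)
  decide

lemma meromorphicOrderAt_mul_wp_add_ge {u : ℂ} (hu : u ∈ Λ) (c d : ℂ) :
    ((-2 : ℤ) : WithTop ℤ) ≤ meromorphicOrderAt ((fun _ ↦ c) * wp + fun _ ↦ d) u := by
  rcases eq_or_ne c 0 with rfl | hc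
  · have : (fun _ : ℂ ↦ (0 : ℂ)) * wp + (fun _ ↦ d) = fun _ ↦ d := by ext; simp
    rw [this]
    refine le_trans ?_ (AnalyticAt.meromorphicOrderAt_nonneg analyticAt_const)
    decide
  · exact (meromorphicOrderAt_mul_wp_add hu hc d).ge

lemma meromorphicOrderAt_combination {u : ℂ} (hu : u ∈ Λ) (c d : ℂ) {g : ℂ} (hg : g ≠ 0) :
    meromorphicOrderAt (((fun _ ↦ c) * wp + fun _ ↦ d) + (fun _ ↦ g) * wp') u =
      ((-3 : ℤ) : WithTop ℤ) := by
  have h1 : meromorphicOrderAt ((fun _ ↦ g) * wp') u = ((-3 : ℤ) : WithTop ℤ) := by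
    rw [meromorphicOrderAt_mul_of_ne_zero analyticAt_const hg, meromorphicOrderAt_wp' hu]
  have hm : MeromorphicAt ((fun _ ↦ c) * wp + fun _ ↦ d) u :=
    ((MeromorphicAt.const c u).mul (gaussianPeriods.meromorphic_weierstrassP u)).add
      (MeromorphicAt.const d u)
  rw [meromorphicOrderAt_add_eq_right_of_lt hm, h1]
  rw [h1]
  exact lt_of_lt_of_le (by decide) (meromorphicOrderAt_mul_wp_add_ge hu c d)

lemma transformForms_eq (A : Matrix (Fin 3) (Fin 3) ℝ) (i : Fin 3) :
    transformForms A forms i = form (fun u ↦ ∑ j, (A i j : ℂ) * formCoeff j u) := by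
  funext x
  have key : ∀ s t : Fin 3 → ℂ, ∑ j, (s j • (t j • ContinuousLinearMap.id ℂ ℂ) : ℂ →L[ℂ] ℂ) =
      (∑ j, s j * t j) • ContinuousLinearMap.id ℂ ℂ := fun s t ↦ by
    ext
    simp
  exact key (fun j ↦ A i j) fun j ↦ formCoeff j (lift x)

/-- Sorted by pole order. The real entries `A i 0` and `A i 1` form one complex coefficient of ℘,
which vanishes only if both do. -/
lemma coeff_transformForms (A : Matrix (Fin 3) (Fin 3) ℝ) (i : Fin 3) (c : SquareTorus) :
    (transformForms A forms i).coeff c =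
      (((fun _ ↦ scale * (A i 0 + I * A i 1)) * wp +
        fun _ ↦ scale * quasiPeriod * (A i 0 - I * A i 1)) +
          (fun _ ↦ (A i 2 / wpHalf : ℂ)) * wp') := by
  rw [transformForms_eq, coeff_form]
  · funext u
    simp only [Fin.sum_univ_three, formCoeff, Matrix.cons_val_zero, Matrix.cons_val_one,
      Matrix.cons_val, Pi.add_apply, Pi.mul_apply]
    ring
  · intro l hl u
    simp only [formCoeff_add hl]

lemma poleOrder_of_ne_zero {A : Matrix (Fin 3) (Fin 3) ℝ} {i : Fin 3} (h : A i 2 ≠ 0) :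
    (transformForms A forms i).poleOrder puncture = 3 := by
  -- The chart sends the puncture to `lift puncture`, an unspecified lattice point; hence the order
  -- lemmas cover all of the lattice.
  rw [OneForm.poleOrder, coeff_transformForms, chartAt_self,
    meromorphicOrderAt_combination (proj_eq_puncture_iff.mp (proj_lift _)) _ _
      (div_ne_zero (ofReal_ne_zero.mpr h) ofReal_wpHalf_ne_zero)]
  rfl

lemma poleOrder_of_eq_zero {A : Matrix (Fin 3) (Fin 3) ℝ} {i : Fin 3} (h : A i 2 = 0)
    (h' : A i ≠ 0) : (transformForms A forms i).poleOrder puncture = 2 := by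
  have hc : (scale * (A i 0 + I * A i 1) : ℂ) ≠ 0 := by
    refine mul_ne_zero (ofReal_ne_zero.mpr scale_pos.ne') fun hz ↦ h' ?_
    have h0 := congrArg re hz
    have h1 := congrArg im hz
    simp at h0 h1
    funext j
    fin_cases j
    · exact h0
    · exact h1
    · exact h
  have e : ∀ F : ℂ → ℂ, F + (fun _ ↦ (0 : ℂ)) * wp' = F := fun F ↦ by ext; simp
  rw [OneForm.poleOrder, coeff_transformForms, chartAt_self, h, ofReal_zero, zero_div, e,
    meromorphicOrderAt_mul_wp_add (proj_eq_puncture_iff.mp (proj_lift _)) hc]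
  rfl

/-- The identity matrix attains the triple. An invertible matrix has no zero row, so all orders are
at least 2, and no zero last column, so some order is 3. -/
lemma isEndType : IsEndType forms puncture ![2, 2, 3] := by
  constructor
  · refine ⟨?_, 1, by simp, ?_⟩
    · intro i j hij
      fin_cases i <;> fin_cases j <;> simp_all
    · intro i
      match i with
      | 0 => exact poleOrder_of_eq_zero (by simp) fun h ↦ by simpa using congrFun h 0
      | 1 => exact poleOrder_of_eq_zero (by simp) fun h ↦ by simpa using congrFun h 1
      | 2 => exact poleOrder_of_ne_zero (by simp)
  · rintro m ⟨hm, A, hA, hord⟩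
    have hrow : ∀ i, A i ≠ 0 := fun i h ↦ by
      rw [Matrix.det_eq_zero_of_row_eq_zero i fun j ↦ congrFun h j] at hA
      exact not_isUnit_zero hA
    have hge : ∀ i, 2 ≤ ofLex m i := by
      intro i
      rw [← hord]
      by_cases h : A i 2 = 0
      · rw [poleOrder_of_eq_zero h (hrow i)]
      · rw [poleOrder_of_ne_zero h]
        norm_num
    have hcol : ∃ i, A i 2 ≠ 0 := by
      by_contra! h
      rw [Matrix.det_eq_zero_of_column_eq_zero 2 h] at hA
      exact not_isUnit_zero hA
    obtain ⟨k, hk⟩ := hcol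
    have h3 : 3 ≤ ofLex m 2 := by
      -- Monotonicity moves the order 3, found at position k, to the last place.
      have := hm (Fin.le_last k)
      rw [← hord k, poleOrder_of_ne_zero hk] at this
      exact this
    have hle : (![2, 2, 3] : Fin 3 → ℕ) ≤ ofLex m := by
      intro i
      fin_cases i
      · exact hge 0
      · exact hge 1
      · exact h3
    exact Pi.toLex_monotone hle

end EndType

end SquareTorus

open SquareTorus in
theorem mainTheorem6 :
    ∃ (X : Type) (_ : TopologicalSpace X) (_ : ChartedSpace ℂ X) (p : X) (z w : X → ℂ)
      (a b : ℝ) (Ω : Fin 3 → OneForm X) (f : X → E3),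
      IsComplexTorus X ∧
      IsAffineCurveModel p z w ∧
      HasTorusForms p z w a b Ω ∧
      IsHarmonicSurface {p} Ω f ∧
      IsHarmonicOff {p} f ∧
      IsEndType Ω p ![2, 2, 3] ∧
      IsProperEmbeddingOff {p} f ∧
      IsCompleteOff {p} f := by
  exact ⟨SquareTorus, inferInstance, inferInstance, puncture, curveZ, curveW, _, _, forms,
    harmonicTorus, isComplexTorus, isAffineCurveModel, hasTorusForms, isHarmonicSurface,
    isHarmonicOff, isEndType, isProperEmbeddingOff, isCompleteOff⟩
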